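/- Let $1\le n\le\infty$ and let $(V,\otimes,I)$ be a symmetric monoidal category. An $n$-ordinal is a finite set $T$ with binary relations $<_p$, indexed by $p\in\{0,\dots,n-1\}$ (by $p\in\{0,-1,-2,\dots\}$ if $n=\infty$), such that each $<_p$ is nonreflexive; for all $a\neq b$ there is exactly one $p$ with $a<_pb$ or $b<_pa$; and $a<_pb$, $b<_qc$ imply $a<_{\min(p,q)}c$. Its total order is: $a<b$ iff $a<_pb$ for some $p$. A map $\sigma:T\to S$ of $n$-ordinals is a function such that $i<_pj$ implies $\sigma(i)<_r\sigma(j)$ for some $r\ge p$, or $\sigma(i)=\sigma(j)$, or $\sigma(j)<_r\sigma(i)$ for some $r>p$. Let $Ord(n)$ be the skeletal category of $n$-ordinals, $U_n$ its terminal object, and $T_s=\sigma^{-1}(s)$ the fibres of $\sigma$. A map is a quasibijection if it is bijective on underlying sets, and order preserving if it preserves the total orders. Let $Q_n$ be the subcategory of quasibijections and $\Pi Q_n$ its fundamental groupoid (its localisation at all morphisms). An $n$-operad in $V$ is a family $(A_T)_{T\in Ord(n)}$ of objects of $V$ with a unit $e:I\to A_{U_n}$ and a multiplication $m_\sigma:A_S\otimes\bigotimes_{s\in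 S}A_{T_s}\to A_T$ for every map $\sigma:T\to S$ (tensor products taken in the total order), satisfying associativity for all composites $T\to S\to R$, and the unit laws for identities $T\to T$ and for the maps $T\to U_n$. The fibres of a quasibijection $\sigma:T\to S$ are all $U_n$, and $A(\sigma):A_S\to A_T$ denotes $m_\sigma$ with $e$ inserted at all fibres. The $n$-operad $A$ is quasisymmetric if $A(\sigma)$ is an isomorphism for every quasibijection $\sigma$. A $Q_n$-operad in $V$ is a functor $C:(\Pi Q_n)^{op}\to V$ with a unit $e:I\to C_{U_n}$ and multiplications $\mu_\sigma:C_S\otimes\bigotimes_{s\in S} C_{T_s}\to C_T$ for the order preserving maps $\sigma:T\to S$ only, satisfying associativity for composites of order preserving maps and both unit laws, and such that: 1. if $\sigma':T'\to S'$ and $\sigma:T\to S$ are order preserving and $\pi:T'\to T$, $\rho:S'\to S$ are quasibijections with $\rho\sigma'=\sigma\pi$, then $C(\pi)\circ\mu_\sigma=\mu_{\sigma'}\circ(C(\rho)\otimes\tau)$, where $\tau:\bigotimes_{s\in S} C_{T_s}\to\bigotimes_{s'\in S'}C_{T'_{s'}}$ is the symmetry given by $\rho$ followed by the maps $C(\pi_{s'})$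 of the induced quasibijections $\pi_{s'}:T'_{s'}\to T_{\rho(s')}$; 2. if $\sigma:T\to T''$, $\sigma':T\to T'$ are quasibijections and $\eta:T''\to S$, $\eta':T'\to S$ are order preserving with $\eta\sigma=\eta'\sigma'$, and $T_s$ are the fibres of this composite, then $$C(\sigma')\circ\mu_{\eta'}=C(\sigma)\circ\mu_\eta\circ\Bigl(1\otimes\bigotimes_{s}C(\sigma_s)^{-1}C(\sigma'_s)\Bigr),$$ where $\sigma_s:T_s\to T''_s$ and $\sigma'_s:T_s\to T'_s$ are the induced quasibijections. Morphisms of $n$-operads are families of morphisms, and morphisms of $Q_n$-operads are natural transformations, compatible with units and multiplications; quasisymmetric $n$-operads form a full subcategory of $n$-operads. **Theorem.** Every map $\sigma:T\to S$ of $n$-ordinals factors as $T\xrightarrow{\pi}T'\xrightarrow{\nu}S$ with $\pi$ a quasibijection, $\nu$ order preserving, and $\pi$ preserving the total order on the fibres of $\sigma$; and there is an equivalence between the category of quasisymmetric $n$-operads in $V$ and the category of $Q_n$-operads in $V$ such that, up to natural isomorphism of the underlying families of objects: * the functor from quasisymmetric $n$-operads to $Q_n$-operads sends $A$ to the family $(A_T)$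 with the action $A(\sigma)$ of quasibijections, the unit of $A$, and the multiplications of $A$ for order preserving maps; * the inverse functor sends $C$ to the family $(C_T)$ with the unit of $C$ and, for every $\sigma=\nu\pi$ with $\pi$ a quasibijection and $\nu$ order preserving, with multiplication $$m_\sigma=C(\pi)\circ\mu_\nu\circ\Bigl(1\otimes\bigotimes_{s\in S}C(\pi_s)^{-1}\Bigr),\qquad \pi_s:T_s\to T'_s \text{ the induced quasibijections of fibres.}$$ -/

import Mathlib

open CategoryTheory MonoidalCategory Opposite

universe v u

noncomputable section

namespace NOperads

/-! ### Ordered tensor products in a symmetric monoidal category -/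

section Tensor

variable {V : Type u} [Category.{v} V] [MonoidalCategory V]

/-- `X a₁ ⊗ (X a₂ ⊗ (⋯ ⊗ 𝟙))`, the tensor product of the family `X` along the list
`[a₁, a₂, …]`. -/
def tens {ι : Type} (X : ι → V) : List ι → V
  | [] => 𝟙_ V
  | a :: l => X a ⊗ tens X l

/-- The tensor product of a family of morphisms. -/
def tensHom {ι : Type} {X Y : ι → V} (f : ∀ i, X i ⟶ Y i) : (l : List ι) → (tens X l ⟶ tens Y l)
  | [] => 𝟙 (𝟙_ V)
  | a :: l => f a ⊗ₘ tensHom f l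

lemma tensHom_id {ι : Type} (X : ι → V) (l : List ι) :
    tensHom (fun i => 𝟙 (X i)) l = 𝟙 (tens X l) := by
  induction l with
  | nil => rfl
  | cons a l ih => simp [tensHom, ih, tens]

lemma tensHom_comp {ι : Type} {X Y Z : ι → V} (f : ∀ i, X i ⟶ Y i) (g : ∀ i, Y i ⟶ Z i)
    (l : List ι) : tensHom (fun i => f i ≫ g i) l = tensHom f l ≫ tensHom g l := by
  induction l with
  | nil => exact (Category.id_comp (𝟙 (𝟙_ V))).symm
  | cons a l ih =>
    change (f a ≫ g a) ⊗ₘ tensHom (fun i => f i ≫ g i) l = (f a ⊗ₘ tensHom f l) ≫ (g a ⊗ₘ tensHom g l)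
    rw [ih, MonoidalCategory.tensorHom_comp_tensorHom]

/-- The canonical morphism `I ⟶ I ⊗ ⋯ ⊗ I`. -/
def tensUnit {ι : Type} : (l : List ι) → (𝟙_ V ⟶ tens (fun _ : ι => 𝟙_ V) l)
  | [] => 𝟙 _
  | _ :: l => (λ_ (𝟙_ V)).inv ≫ (𝟙_ V ◁ tensUnit l)

/-- The tensor product along a concatenation (associativity). -/
def tensAppend {ι : Type} (X : ι → V) :
    (l l' : List ι) → (tens X (l ++ l') ≅ tens X l ⊗ tens X l')
  | [], l' => (λ_ (tens X l')).symm
  | a :: l, l' => whiskerLeftIso (X a) (tensAppend X l l') ≪≫ (α_ (X a) (tens X l) (tens X l')).symm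

/-- Reindexing along a map of index sets. -/
def tensMap {ι κ : Type} (X : ι → V) (g : κ → ι) :
    (l : List κ) → (tens X (l.map g) ≅ tens (fun j => X (g j)) l)
  | [] => Iso.refl _
  | a :: l => whiskerLeftIso (X (g a)) (tensMap X g l)

/-- The tensor product along a concatenation of many lists (associativity). -/
def tensFlatMap {ι κ : Type} (X : ι → V) (g : κ → List ι) :
    (l : List κ) → (tens X (l.flatMap g) ≅ tens (fun r => tens X (g r)) l)
  | [] => Iso.refl _
  | r :: l => tensAppend X (g r) (l.flatMap g) ≪≫ whiskerLeftIso (tens X (g r)) (tensFlatMap X g l)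

variable [SymmetricCategory V]

/-- The symmetry which moves the (first occurrence of the) factor `X a` to the front. -/
def tensExtract {ι : Type} [DecidableEq ι] (X : ι → V) (a : ι) :
    (l : List ι) → a ∈ l → (tens X l ≅ X a ⊗ tens X (l.erase a))
  | [], h => absurd h List.not_mem_nil
  | b :: l, h =>
    if hab : b = a then
      eqToIso (by subst hab; rw [List.erase_cons_head]; rfl)
    else
      whiskerLeftIso (X b) (tensExtract X a l (by
        rcases List.mem_cons.1 h with h | h
        · exact absurd h.symm hab
        · exact h)) ≪≫
      (α_ (X b) (X a) (tens X (l.erase a))).symm ≪≫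
      whiskerRightIso (β_ (X b) (X a)) (tens X (l.erase a)) ≪≫
      α_ (X a) (X b) (tens X (l.erase a)) ≪≫
      eqToIso (by rw [List.erase_cons_tail (by simpa using hab)]; rfl)

/-- The symmetry of `V` that permutes the factors; it is used for lists without repetitions, for
which the permutation is determined by the two lists. -/
def tensPerm {ι : Type} [DecidableEq ι] (X : ι → V) :
    (l l' : List ι) → l.Perm l' → (tens X l ≅ tens X l')
  | l, [], h => eqToIso (by rw [h.eq_nil])
  | l, b :: l', h =>
    tensExtract X b l (h.mem_iff.2 List.mem_cons_self) ≪≫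
      whiskerLeftIso (X b) (tensPerm X (l.erase b) l' (by
        have := h.erase b
        rwa [List.erase_cons_head] at this))

/-- The symmetry `(⨂ Xᵢ) ⊗ (⨂ Yᵢ) ⟶ ⨂ (Xᵢ ⊗ Yᵢ)`. -/
def tensZip {ι : Type} (X Y : ι → V) :
    (l : List ι) → (tens X l ⊗ tens Y l ⟶ tens (fun i => X i ⊗ Y i) l)
  | [] => (λ_ (𝟙_ V)).hom
  | a :: l => tensorμ (X a) (tens X l) (Y a) (tens Y l) ≫ ((X a ⊗ Y a) ◁ tensZip X Y l)

end Tensor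

/-! ### The category of `n`-ordinals -/

/-- The index set of the relations: `0, …, n - 1` for finite `n`, and `0, -1, -2, …` for
`n = ∞`. -/
def Level : ℕ∞ → Type
  | some n => Fin n
  | none => {p : ℤ // p ≤ 0}

instance : (n : ℕ∞) → LinearOrder (Level n)
  | some n => inferInstanceAs (LinearOrder (Fin n))
  | none => inferInstanceAs (LinearOrder {p : ℤ // p ≤ 0})

section Ordinals

variable {I : Type} [LinearOrder I]

/-- The structure of an `n`-ordinal on a (finite) set `T`, where `I` is the index set of the
relations `<_p`. -/
structure OrdinalStructure (I : Type) [LinearOrder I] (T : Type) where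
  rel : I → T → T → Prop
  irrefl : ∀ p a, ¬ rel p a a
  existsUnique : ∀ a b, a ≠ b → ∃! p, rel p a b ∨ rel p b a
  trans : ∀ p q a b c, rel p a b → rel q b c → rel (min p q) a c

/-- Objects of the skeletal category of `n`-ordinals. Every `n`-ordinal is isomorphic, by a unique
isomorphism, to exactly one whose underlying set is `{0, …, k - 1}` and whose total order
(`a < b` iff `a <_p b` for some `p`) is the usual one. -/
structure NOrd (I : Type) [LinearOrder I] where
  card : ℕ
  str : OrdinalStructure I (Fin card)
  total : ∀ a b, a < b ↔ ∃ p, str.rel p a b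

namespace NOrd

/-- The relation `a <_p b`. -/
abbrev rel (T : NOrd I) (p : I) (a b : Fin T.card) : Prop := T.str.rel p a b

/-- Maps of `n`-ordinals. -/
@[ext]
structure Hom (T S : NOrd I) where
  toFun : Fin T.card → Fin S.card
  map_rel : ∀ (p : I) (i j : Fin T.card), T.rel p i j →
    (∃ r, p ≤ r ∧ S.rel r (toFun i) (toFun j)) ∨ toFun i = toFun j ∨
      (∃ r, p < r ∧ S.rel r (toFun j) (toFun i))

instance : Category (NOrd I) where
  Hom T S := Hom T S
  id T := ⟨id, fun p _ _ h => Or.inl ⟨p, le_rfl, h⟩⟩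
  comp {T S R} f g := ⟨fun a => g.toFun (f.toFun a), by
    intro p i j h
    rcases f.map_rel p i j h with ⟨r, hr, h1⟩ | h1 | ⟨r, hr, h1⟩
    · rcases g.map_rel r _ _ h1 with ⟨q, hq, h2⟩ | h2 | ⟨q, hq, h2⟩
      · exact Or.inl ⟨q, hr.trans hq, h2⟩
      · exact Or.inr (Or.inl h2)
      · exact Or.inr (Or.inr ⟨q, hr.trans_lt hq, h2⟩)
    · exact Or.inr (Or.inl (by rw [h1]))
    · rcases g.map_rel r _ _ h1 with ⟨q, hq, h2⟩ | h2 | ⟨q, hq, h2⟩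
      · exact Or.inr (Or.inr ⟨q, hr.trans_le hq, h2⟩)
      · exact Or.inr (Or.inl h2.symm)
      · exact Or.inl ⟨q, (hr.trans hq).le, h2⟩⟩

/-- The underlying function of a map of `n`-ordinals. -/
def fn {T S : NOrd I} (σ : T ⟶ S) : Fin T.card → Fin S.card := Hom.toFun σ

@[simp] lemma fn_id (T : NOrd I) (a : Fin T.card) : fn (𝟙 T) a = a := rfl

@[simp] lemma fn_comp {T S R : NOrd I} (σ : T ⟶ S) (ω : S ⟶ R) (a : Fin T.card) :
    fn (σ ≫ ω) a = fn ω (fn σ a) := rfl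

/-- The elements of an `n`-ordinal, in the total order. -/
abbrev elems (T : NOrd I) : List (Fin T.card) := List.finRange T.card

/-- An `n`-ordinal of the skeleton is determined by the substructure it embeds onto. -/
lemma eq_of_embedding {T T₁ T₂ : NOrd I} (g₁ : Fin T₁.card → Fin T.card)
    (g₂ : Fin T₂.card → Fin T.card) (h₁ : StrictMono g₁) (h₂ : StrictMono g₂)
    (r₁ : ∀ p a b, T₁.rel p a b ↔ T.rel p (g₁ a) (g₁ b))
    (r₂ : ∀ p a b, T₂.rel p a b ↔ T.rel p (g₂ a) (g₂ b))
    (hr : Set.range g₁ = Set.range g₂) : T₁ = T₂ := by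
  obtain ⟨k₁, ⟨s₁, i₁, e₁, t₁⟩, o₁⟩ := T₁
  obtain ⟨k₂, ⟨s₂, i₂, e₂, t₂⟩, o₂⟩ := T₂
  have hk : k₁ = k₂ := by
    have := congrArg Set.ncard hr
    rw [← Set.image_univ, ← Set.image_univ, Set.ncard_image_of_injective _ h₁.injective,
      Set.ncard_image_of_injective _ h₂.injective, Set.ncard_univ, Set.ncard_univ] at this
    simpa using this
  subst hk
  have hg : g₁ = g₂ := (StrictMono.range_inj h₁ h₂).1 hr
  subst hg
  have hs : s₁ = s₂ := by
    funext p a b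
    exact propext ((r₁ p a b).trans (r₂ p a b).symm)
  subst hs
  rfl

/-- The terminal `n`-ordinal `U_n`. -/
def unit (I : Type) [LinearOrder I] : NOrd I where
  card := 1
  str :=
    { rel := fun _ _ _ => False
      irrefl := fun _ _ h => h
      existsUnique := fun a b h => absurd (Subsingleton.elim a b) h
      trans := fun _ _ _ _ _ h => h.elim }
  total := fun a b => by
    have : a = b := Subsingleton.elim a b
    simp [this]

/-- The unique map `T ⟶ U_n`. -/
def toUnit (T : NOrd I) : T ⟶ unit I :=
  (⟨fun _ => (0 : Fin 1), fun _ _ _ _ => Or.inr (Or.inl rfl)⟩ : Hom T (unit I))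

lemma toUnit_unique {T : NOrd I} (σ : T ⟶ unit I) : σ = toUnit T :=
  Hom.ext (funext fun _ => Subsingleton.elim (α := Fin 1) _ _)

/-! ### Fibres -/

/-- The underlying set of the fibre `σ⁻¹(s)`. -/
def fibreSet {T S : NOrd I} (σ : T ⟶ S) (s : Fin S.card) : Finset (Fin T.card) :=
  Finset.univ.filter fun t => fn σ t = s

lemma mem_fibreSet {T S : NOrd I} {σ : T ⟶ S} {s : Fin S.card} {t : Fin T.card} :
    t ∈ fibreSet σ s ↔ fn σ t = s := by simp [fibreSet]

/-- The increasing enumeration of the fibre `σ⁻¹(s)`. -/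
def fibreEnum {T S : NOrd I} (σ : T ⟶ S) (s : Fin S.card) :
    Fin (fibreSet σ s).card ≃o fibreSet σ s := (fibreSet σ s).orderIsoOfFin rfl

/-- The fibre `σ⁻¹(s)` with the induced structure, as an object of the skeleton. -/
def fibre {T S : NOrd I} (σ : T ⟶ S) (s : Fin S.card) : NOrd I where
  card := (fibreSet σ s).card
  str :=
    { rel := fun p a b => T.rel p (fibreEnum σ s a) (fibreEnum σ s b)
      irrefl := fun p _ => T.str.irrefl p _
      existsUnique := fun a b h => T.str.existsUnique _ _ fun h' =>
        h ((fibreEnum σ s).injective (Subtype.ext h'))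
      trans := fun p q _ _ _ => T.str.trans p q _ _ _ }
  total := fun a b => by
    rw [← T.total, Subtype.coe_lt_coe, OrderIso.lt_iff_lt]

/-- The inclusion of the fibre `σ⁻¹(s)` into `T`. -/
def fibreIncl {T S : NOrd I} (σ : T ⟶ S) (s : Fin S.card) (a : Fin (fibre σ s).card) :
    Fin T.card := (fibreEnum σ s a : Fin T.card)

lemma fibreIncl_strictMono {T S : NOrd I} (σ : T ⟶ S) (s : Fin S.card) :
    StrictMono (fibreIncl σ s) := fun _ _ h => (fibreEnum σ s).strictMono h

lemma fn_fibreIncl {T S : NOrd I} (σ : T ⟶ S) (s : Fin S.card) (a : Fin (fibre σ s).card) :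
    fn σ (fibreIncl σ s a) = s := mem_fibreSet.1 (fibreEnum σ s a).2

lemma range_fibreIncl {T S : NOrd I} (σ : T ⟶ S) (s : Fin S.card) :
    Set.range (fibreIncl σ s) = {t | fn σ t = s} := by
  ext t
  constructor
  · rintro ⟨a, rfl⟩
    exact fn_fibreIncl σ s a
  · intro h
    refine ⟨(fibreEnum σ s).symm ⟨t, mem_fibreSet.2 h⟩, ?_⟩
    change ((fibreEnum σ s ((fibreEnum σ s).symm _) : _) : Fin T.card) = t
    rw [OrderIso.apply_symm_apply]

/-- If `π : T' ⟶ T` sends the fibre of `σ'` over `s'` into the fibre of `σ` over `s`, this is the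
induced map of the fibres. -/
def fibreMap {T' S' T S : NOrd I} (π : T' ⟶ T) (σ' : T' ⟶ S') (σ : T ⟶ S) (s' : Fin S'.card)
    (s : Fin S.card) (h : ∀ t, fn σ' t = s' → fn σ (fn π t) = s) : fibre σ' s' ⟶ fibre σ s :=
  (⟨fun a => (fibreEnum σ s).symm
      ⟨fn π (fibreIncl σ' s' a), mem_fibreSet.2 (h _ (fn_fibreIncl σ' s' a))⟩, by
    intro p i j hij
    have key := Hom.map_rel π p _ _ hij
    have aux : ∀ (t : Fin T.card) (ht : t ∈ fibreSet σ s),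
        ((fibreEnum σ s ((fibreEnum σ s).symm ⟨t, ht⟩) : _) : Fin T.card) = t := fun t ht => by
      rw [OrderIso.apply_symm_apply]
    rcases key with ⟨r, hr, h1⟩ | h1 | ⟨r, hr, h1⟩
    · refine Or.inl ⟨r, hr, ?_⟩
      change T.rel r (fibreEnum σ s _ : Fin T.card) (fibreEnum σ s _ : Fin T.card)
      rw [aux, aux]
      exact h1
    · exact Or.inr (Or.inl (congrArg (fibreEnum σ s).symm (Subtype.ext h1)))
    · refine Or.inr (Or.inr ⟨r, hr, ?_⟩)
      change T.rel r (fibreEnum σ s _ : Fin T.card) (fibreEnum σ s _ : Fin T.card)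
      rw [aux, aux]
      exact h1⟩ : Hom (fibre σ' s') (fibre σ s))

@[simp] lemma fibreIncl_fibreMap {T' S' T S : NOrd I} (π : T' ⟶ T) (σ' : T' ⟶ S') (σ : T ⟶ S)
    (s' : Fin S'.card) (s : Fin S.card) (h : ∀ t, fn σ' t = s' → fn σ (fn π t) = s)
    (a : Fin (fibre σ' s').card) :
    fibreIncl σ s (fn (fibreMap π σ' σ s' s h) a) = fn π (fibreIncl σ' s' a) := by
  change ((fibreEnum σ s ((fibreEnum σ s).symm _) : _) : Fin T.card) = _
  rw [OrderIso.apply_symm_apply]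

/-- For `σ : T ⟶ S` and `ω : S ⟶ R`, the `r`-th fibre `σ_r : T_r ⟶ S_r` of `σ`. -/
def restr {T S R : NOrd I} (σ : T ⟶ S) (ω : S ⟶ R) (r : Fin R.card) :
    fibre (σ ≫ ω) r ⟶ fibre ω r := fibreMap σ (σ ≫ ω) ω r r fun t h => (fn_comp σ ω t).symm.trans h

/-- The fibre of `σ_r : T_r ⟶ S_r` over an element of `S_r` is the fibre of `σ` over that
element. -/
lemma fibre_restr {T S R : NOrd I} (σ : T ⟶ S) (ω : S ⟶ R) (r : Fin R.card)
    (j : Fin (fibre ω r).card) : fibre σ (fibreIncl ω r j) = fibre (restr σ ω r) j := by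
  refine eq_of_embedding (T := T) (fibreIncl σ _)
    (fun a => fibreIncl (σ ≫ ω) r (fibreIncl (restr σ ω r) j a)) (fibreIncl_strictMono _ _)
    ((fibreIncl_strictMono _ _).comp (fibreIncl_strictMono _ _)) (fun _ _ _ => Iff.rfl)
    (fun _ _ _ => Iff.rfl) ?_
  rw [range_fibreIncl, Set.range_comp' (fibreIncl (σ ≫ ω) r), range_fibreIncl]
  ext t
  constructor
  · intro ht
    have ht' : fn σ t = fibreIncl ω r j := ht
    obtain ⟨a, ha⟩ : t ∈ Set.range (fibreIncl (σ ≫ ω) r) := by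
      rw [range_fibreIncl]
      change fn (σ ≫ ω) t = r
      rw [fn_comp, ht', fn_fibreIncl]
    refine ⟨a, (fibreIncl_strictMono ω r).injective ?_, ha⟩
    rw [restr, fibreIncl_fibreMap, ha, ht']
  · rintro ⟨a, ha, rfl⟩
    change fn σ _ = _
    have ha' : fn (restr σ ω r) a = j := ha
    rw [← ha', restr, fibreIncl_fibreMap]

/-- The fibre of `T ⟶ U_n` is `T`. -/
lemma fibre_toUnit (T : NOrd I) (s : Fin (unit I).card) : T = fibre (toUnit T) s := by
  refine eq_of_embedding (T := T) id (fibreIncl _ _) strictMono_id (fibreIncl_strictMono _ _)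
    (fun _ _ _ => Iff.rfl) (fun _ _ _ => Iff.rfl) ?_
  rw [range_fibreIncl, Set.range_id]
  ext t
  simp only [Set.mem_univ, Set.mem_ofPred_eq, true_iff]
  exact Subsingleton.elim (α := Fin 1) _ _

/-! ### Quasibijections and order preserving maps -/

/-- Quasibijections: the maps of `n`-ordinals that are bijective on underlying sets. -/
def quasibijections (I : Type) [LinearOrder I] : MorphismProperty (NOrd I) :=
  fun _ _ σ => Function.Bijective (fn σ)

/-- The maps of `n`-ordinals that preserve the total orders. -/
def orderPreserving (I : Type) [LinearOrder I] : MorphismProperty (NOrd I) :=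
  fun _ _ σ => Monotone (fn σ)

instance : (quasibijections I).IsMultiplicative where
  id_mem _ := Function.bijective_id
  comp_mem _ _ h₁ h₂ := h₂.comp h₁

/-- The fibres of a quasibijection are terminal. -/
lemma fibre_quasibijection {T S : NOrd I} {σ : T ⟶ S} (hσ : quasibijections I σ)
    (s : Fin S.card) : unit I = fibre σ s := by
  obtain ⟨t, ht⟩ := hσ.2 s
  refine eq_of_embedding (T := T) (fun _ => t) (fibreIncl σ s) (Subsingleton.strictMono
    (α := Fin 1) _) (fibreIncl_strictMono _ _) (fun p a b => ?_) (fun _ _ _ => Iff.rfl) ?_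
  · exact ⟨fun h => h.elim, fun h => T.str.irrefl p t h⟩
  · rw [range_fibreIncl]
    ext t'
    constructor
    · rintro ⟨_, rfl⟩
      exact ht
    · intro h
      exact ⟨(0 : Fin 1), hσ.1 (ht.trans (Eq.symm h))⟩

/-- A commutative square `σ' ≫ ρ = π ≫ σ` whose vertical maps `π : T' ⟶ T`, `ρ : S' ⟶ S` are
quasibijections induces quasibijections of the fibres. -/
lemma quasibijections_fibreMap {T' S' T S : NOrd I} {π : T' ⟶ T} {σ' : T' ⟶ S'} {σ : T ⟶ S}
    {ρ : S' ⟶ S} (hπ : quasibijections I π) (hρ : quasibijections I ρ) (w : σ' ≫ ρ = π ≫ σ)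
    (s' : Fin S'.card) (s : Fin S.card) (hs : fn ρ s' = s)
    (h : ∀ t, fn σ' t = s' → fn σ (fn π t) = s) :
    quasibijections I (fibreMap π σ' σ s' s h) := by
  constructor
  · intro a b hab
    have := congrArg (fibreIncl σ s) hab
    rw [fibreIncl_fibreMap, fibreIncl_fibreMap] at this
    exact (fibreIncl_strictMono σ' s').injective (hπ.1 this)
  · intro b
    obtain ⟨t', ht'⟩ := hπ.2 (fibreIncl σ s b)
    have h' : t' ∈ Set.range (fibreIncl σ' s') := by
      rw [range_fibreIncl]
      apply hρ.1
      rw [← fn_comp, w, fn_comp, ht', fn_fibreIncl, hs]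
    obtain ⟨a, rfl⟩ := h'
    refine ⟨a, (fibreIncl_strictMono σ s).injective ?_⟩
    rw [fibreIncl_fibreMap, ht']

end NOrd

open NOrd

/-- The closure properties that make sense of operads whose multiplications are indexed by the maps
in `W` only. -/
class IsOperadic (W : MorphismProperty (NOrd I)) : Prop where
  id_mem : ∀ T : NOrd I, W (𝟙 T)
  toUnit_mem : ∀ T : NOrd I, W (toUnit T)
  comp_mem : ∀ {T S R : NOrd I} (σ : T ⟶ S) (ω : S ⟶ R), W σ → W ω → W (σ ≫ ω)
  restr_mem : ∀ {T S R : NOrd I} (σ : T ⟶ S) (ω : S ⟶ R), W σ → W ω → ∀ r, W (restr σ ω r)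

instance : IsOperadic (⊤ : MorphismProperty (NOrd I)) where
  id_mem _ := trivial
  toUnit_mem _ := trivial
  comp_mem _ _ _ _ := trivial
  restr_mem _ _ _ _ _ := trivial

instance : IsOperadic (orderPreserving I) where
  id_mem _ := monotone_id
  toUnit_mem _ := fun _ _ _ => le_rfl
  comp_mem _ _ h₁ h₂ := h₂.comp h₁
  restr_mem σ ω h _ r := fun a b hab => by
    rw [← (fibreIncl_strictMono ω r).le_iff_le, restr, fibreIncl_fibreMap, fibreIncl_fibreMap]
    exact h ((fibreIncl_strictMono _ r).monotone hab)

/-- The list of all elements of `S` is a permutation of the concatenation of the fibres of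
`ω : S ⟶ R`. -/
lemma perm_fibres {S R : NOrd I} (ω : S ⟶ R) :
    S.elems.Perm (R.elems.flatMap fun r => (fibre ω r).elems.map (fibreIncl ω r)) := by
  rw [List.perm_ext_iff_of_nodup (List.nodup_finRange _)]
  · intro s
    simp only [List.mem_finRange, List.mem_flatMap, List.mem_map, true_and, true_iff]
    have : s ∈ Set.range (fibreIncl ω (fn ω s)) := by
      rw [range_fibreIncl]
      rfl
    exact ⟨fn ω s, this⟩
  · rw [List.nodup_flatMap]
    refine ⟨fun r _ => (List.nodup_finRange _).map (fibreIncl_strictMono ω r).injective, ?_⟩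
    refine (List.nodup_finRange R.card).imp fun {r r'} hrr' => ?_
    intro s hs hs'
    simp only [List.mem_map, List.mem_finRange, true_and] at hs hs'
    obtain ⟨a, rfl⟩ := hs
    obtain ⟨a', ha'⟩ := hs'
    apply hrr'
    rw [← fn_fibreIncl ω r a, ← ha', fn_fibreIncl]

/-- A bijection permutes the list of all elements. -/
lemma perm_bijection {S' S : NOrd I} {ρ : S' ⟶ S} (hρ : quasibijections I ρ) :
    S.elems.Perm (S'.elems.map (fn ρ)) := by
  rw [List.perm_ext_iff_of_nodup (List.nodup_finRange _) ((List.nodup_finRange _).map hρ.1)]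
  intro s
  simp only [List.mem_finRange, List.mem_map, true_and, true_iff]
  exact hρ.2 s

/-! ### Operads -/

variable {V : Type u} [Category.{v} V] [MonoidalCategory V] [SymmetricCategory V]

/-- `A_{T_0} ⊗ ⋯ ⊗ A_{T_k}`, the tensor product over the fibres of `σ : T ⟶ S`. -/
abbrev fibreTens (X : NOrd I → V) {T S : NOrd I} (σ : T ⟶ S) : V :=
  tens (fun s => X (fibre σ s)) S.elems

/-- The symmetry
`A_{S_0} ⊗ ⋯ ⊗ A_{S_k} ⊗ ⨂_{s ∈ S} A_{T_s} ⟶ ⨂_{r ∈ R} (A_{S_r} ⊗ ⨂_{j ∈ S_r} A_{(T_r)_j})`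
for `σ : T ⟶ S` and `ω : S ⟶ R`. -/
def shuffle (X : NOrd I → V) {T S R : NOrd I} (σ : T ⟶ S) (ω : S ⟶ R) :
    fibreTens X ω ⊗ fibreTens X σ ⟶
      tens (fun r => X (fibre ω r) ⊗ fibreTens X (restr σ ω r)) R.elems :=
  (fibreTens X ω ◁
    ((tensPerm (fun s => X (fibre σ s)) _ _ (perm_fibres ω)).hom ≫
      (tensFlatMap (fun s => X (fibre σ s))
        (fun r => (fibre ω r).elems.map (fibreIncl ω r)) R.elems).hom ≫
      tensHom (fun r => (tensMap (fun s => X (fibre σ s)) (fibreIncl ω r) (fibre ω r).elems).hom ≫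
        tensHom (fun j => eqToHom (congrArg X (fibre_restr σ ω r j))) _) R.elems)) ≫
    tensZip (fun r => X (fibre ω r)) (fun r => fibreTens X (restr σ ω r)) R.elems

/-- For a quasibijection `σ : T ⟶ S`, the morphism
`A_S ⟶ A_S ⊗ (I ⊗ ⋯ ⊗ I) ⟶ A_S ⊗ (A_{T_0} ⊗ ⋯ ⊗ A_{T_k})` given by `e : I ⟶ A_{U_n}`, all
fibres `T_i` being `U_n`. -/
def insertUnits {X : NOrd I → V} (e : 𝟙_ V ⟶ X (unit I)) {T S : NOrd I} (σ : T ⟶ S)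
    (hσ : quasibijections I σ) : X S ⟶ X S ⊗ fibreTens X σ :=
  (ρ_ (X S)).inv ≫ (X S ◁ (tensUnit S.elems ≫
    tensHom (fun s => e ≫ eqToHom (congrArg X (fibre_quasibijection hσ s))) S.elems))

/-- Operad structures on the collection `X`, with multiplications for the maps in `W` only. -/
structure OperadStr (W : MorphismProperty (NOrd I)) [IsOperadic W] (X : NOrd I → V) where
  /-- the unit -/
  e : 𝟙_ V ⟶ X (unit I)
  /-- the multiplication -/
  mul : ∀ {T S : NOrd I} (σ : T ⟶ S), W σ → (X S ⊗ fibreTens X σ ⟶ X T)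
  assoc : ∀ {T S R : NOrd I} (σ : T ⟶ S) (ω : S ⟶ R) (hσ : W σ) (hω : W ω),
    (mul ω hω ▷ fibreTens X σ) ≫ mul σ hσ =
      (α_ (X R) (fibreTens X ω) (fibreTens X σ)).hom ≫
        (X R ◁ (shuffle X σ ω ≫
          tensHom (fun r => mul (restr σ ω r) (IsOperadic.restr_mem σ ω hσ hω r)) R.elems)) ≫
        mul (σ ≫ ω) (IsOperadic.comp_mem σ ω hσ hω)
  mul_id : ∀ T : NOrd I,
    insertUnits e (𝟙 T) (MorphismProperty.id_mem _ T) ≫ mul (𝟙 T) (IsOperadic.id_mem T) = 𝟙 (X T)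
  mul_toUnit : ∀ T : NOrd I,
    (λ_ (X T)).inv ≫
      (e ⊗ₘ ((ρ_ (X T)).inv ≫ (eqToHom (congrArg X (fibre_toUnit T (0 : Fin 1))) ▷ 𝟙_ V))) ≫
      mul (toUnit T) (IsOperadic.toUnit_mem T) = 𝟙 (X T)

namespace OperadStr

variable {W : MorphismProperty (NOrd I)} [IsOperadic W]

/-- A family of morphisms that respects the unit and the multiplications. -/
structure IsHom {X Y : NOrd I → V} (A : OperadStr W X) (B : OperadStr W Y)
    (f : ∀ T, X T ⟶ Y T) : Prop where
  e_comp : A.e ≫ f (unit I) = B.e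
  mul_comp : ∀ {T S : NOrd I} (σ : T ⟶ S) (hσ : W σ),
    A.mul σ hσ ≫ f T = (f S ⊗ₘ tensHom (fun s => f (fibre σ s)) S.elems) ≫ B.mul σ hσ

/-- Forget the multiplications for the maps that are not order preserving. -/
def restrict {X : NOrd I → V} (A : OperadStr ⊤ X) : OperadStr (orderPreserving I) X where
  e := A.e
  mul σ _ := A.mul σ trivial
  assoc σ ω _ _ := A.assoc σ ω trivial trivial
  mul_id := A.mul_id
  mul_toUnit := A.mul_toUnit

/-- For an `n`-operad `A` and a quasibijection `σ : T ⟶ S`, the morphism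
`A(σ) : A_S ⟶ A_T`. -/
def act {X : NOrd I → V} (A : OperadStr ⊤ X) {T S : NOrd I} (σ : T ⟶ S)
    (hσ : quasibijections I σ) : X S ⟶ X T :=
  insertUnits A.e σ hσ ≫ A.mul σ trivial

end OperadStr

lemma OperadStr.IsHom.id {W : MorphismProperty (NOrd I)} [IsOperadic W] {X : NOrd I → V}
    (A : OperadStr W X) : A.IsHom A fun T => 𝟙 (X T) where
  e_comp := by simp
  mul_comp σ hσ := by rw [tensHom_id]; simp

lemma OperadStr.IsHom.comp {W : MorphismProperty (NOrd I)} [IsOperadic W] {X Y Z : NOrd I → V}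
    {A : OperadStr W X} {B : OperadStr W Y} {C : OperadStr W Z} {f : ∀ T, X T ⟶ Y T}
    {g : ∀ T, Y T ⟶ Z T} (hf : A.IsHom B f) (hg : B.IsHom C g) :
    A.IsHom C fun T => f T ≫ g T where
  e_comp := by rw [← Category.assoc, hf.e_comp, hg.e_comp]
  mul_comp σ hσ := by
    rw [← Category.assoc, hf.mul_comp, Category.assoc, hg.mul_comp, tensHom_comp,
      ← MonoidalCategory.tensorHom_comp_tensorHom, Category.assoc]

end Ordinals

open NOrd

section Categories

variable (I : Type) [LinearOrder I]
variable (V : Type u) [Category.{v} V] [MonoidalCategory V] [SymmetricCategory V]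

/-- `n`-operads in `V`. -/
structure NOperad where
  X : NOrd I → V
  str : OperadStr ⊤ X

variable {I V} in
/-- Morphisms of `n`-operads. -/
@[ext]
structure NOperad.Hom (A B : NOperad I V) where
  app : ∀ T, A.X T ⟶ B.X T
  isHom : A.str.IsHom B.str app

instance : Category (NOperad I V) where
  Hom A B := NOperad.Hom A B
  id A := ⟨fun T => 𝟙 (A.X T), OperadStr.IsHom.id A.str⟩
  comp f g := ⟨fun T => f.app T ≫ g.app T, f.isHom.comp g.isHom⟩
  id_comp _ := NOperad.Hom.ext (funext fun _ => Category.id_comp _)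
  comp_id _ := NOperad.Hom.ext (funext fun _ => Category.comp_id _)
  assoc _ _ _ := NOperad.Hom.ext (funext fun _ => Category.assoc _ _ _)

/-- An `n`-operad is quasisymmetric if all quasibijections act by isomorphisms. -/
def isQuasisymmetric : ObjectProperty (NOperad I V) :=
  fun A => ∀ {T S : NOrd I} (σ : T ⟶ S) (hσ : quasibijections I σ), IsIso (A.str.act σ hσ)

/-- The category of quasisymmetric `n`-operads, a full subcategory of `n`-operads. -/
abbrev QuasisymmetricOperad := (isQuasisymmetric I V).FullSubcategory

/-- The category of quasibijections. -/
abbrev QCat := WideSubcategory (quasibijections I)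

/-- The fundamental groupoid of the category of quasibijections, i.e. its localisation at all
morphisms. -/
abbrev PiQ := FreeGroupoid (QCat I)

/-- Contravariant functors on the fundamental groupoid of the category of quasibijections. -/
abbrev PiQCollection := (PiQ I)ᵒᵖ ⥤ V

end Categories

section QOperads

variable {I : Type} [LinearOrder I]
variable {V : Type u} [Category.{v} V] [MonoidalCategory V] [SymmetricCategory V]

namespace PiQCollection

/-- The value at an `n`-ordinal. -/
abbrev val (F : PiQCollection I V) (T : NOrd I) : V := F.obj (op (FreeGroupoid.mk ⟨T⟩))

/-- The action `F_S ⟶ F_T` of a quasibijection `σ : T ⟶ S`. -/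
def act (F : PiQCollection I V) {T S : NOrd I} (σ : T ⟶ S) (hσ : quasibijections I σ) :
    F.val S ⟶ F.val T :=
  F.map (FreeGroupoid.homMk (C := QCat I) (X := ⟨T⟩) (Y := ⟨S⟩)
    (InducedWideCategory.Hom.mk σ hσ)).op

instance (F : PiQCollection I V) {T S : NOrd I} (σ : T ⟶ S) (hσ : quasibijections I σ) :
    IsIso (F.act σ hσ) := by
  unfold act
  infer_instance

end PiQCollection

variable (I V) in
/-- `Q_n`-operads in `V`. -/
structure QOperad where
  F : PiQCollection I V
  str : OperadStr (orderPreserving I) F.val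
  /-- Equivariance with respect to commutative squares
  `T' -σ'→ S'`, `T -σ→ S` with order preserving horizontal maps `σ'`, `σ` and vertical
  quasibijections `π : T' ⟶ T`, `ρ : S' ⟶ S`. The morphism
  `F_S ⊗ ⨂_s F_{T_s} ⟶ F_{S'} ⊗ ⨂_{s'} F_{T'_{s'}}` is `F(ρ)` tensored with the symmetry given by
  `ρ` followed by the action of the quasibijections `T'_{s'} ⟶ T_{ρ(s')}` induced by `π`. -/
  equivariance₁ : ∀ {T' S' T S : NOrd I} (σ' : T' ⟶ S') (σ : T ⟶ S) (π : T' ⟶ T) (ρ : S' ⟶ S)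
    (hσ' : orderPreserving I σ') (hσ : orderPreserving I σ) (hπ : quasibijections I π)
    (hρ : quasibijections I ρ) (w : σ' ≫ ρ = π ≫ σ),
    str.mul σ hσ ≫ F.act π hπ =
      (F.act ρ hρ ⊗ₘ
        ((tensPerm (fun s => F.val (fibre σ s)) _ _ (perm_bijection hρ)).hom ≫
          (tensMap (fun s => F.val (fibre σ s)) (fn ρ) S'.elems).hom ≫
          tensHom (fun s' => F.act
            (fibreMap π σ' σ s' (fn ρ s') fun t ht => by rw [← fn_comp, ← w, fn_comp, ht])
            (quasibijections_fibreMap hπ hρ w s' _ rfl _)) S'.elems)) ≫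
      str.mul σ' hσ'
  /-- Equivariance with respect to commutative squares `σ ≫ η = σ' ≫ η'` with quasibijections
  `σ : T ⟶ T''`, `σ' : T ⟶ T'` and order preserving `η : T'' ⟶ S`, `η' : T' ⟶ S`. With `T_s` the
  fibres of the common composite `T ⟶ S`, the two morphisms from `F_S ⊗ ⨂_s F_{T'_s}` to `F_T`,
  through `F_{T'}` and through `F_S ⊗ ⨂_s F_{T_s}`, `F_S ⊗ ⨂_s F_{T''_s}` and `F_{T''}`,
  coincide. -/
  equivariance₂ : ∀ {T T' T'' S : NOrd I} (σ : T ⟶ T'') (η : T'' ⟶ S) (σ' : T ⟶ T')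
    (η' : T' ⟶ S) (f : T ⟶ S) (hσ : quasibijections I σ) (hη : orderPreserving I η)
    (hσ' : quasibijections I σ') (hη' : orderPreserving I η') (w : f = σ ≫ η) (w' : f = σ' ≫ η'),
    str.mul η' hη' ≫ F.act σ' hσ' =
      (F.val S ◁ tensHom (fun s =>
        F.act (fibreMap σ' f η' s s fun t ht => by rw [← fn_comp, ← w', ht])
          (quasibijections_fibreMap hσ' (MorphismProperty.id_mem _ S)
            ((Category.comp_id f).trans w') s s rfl _) ≫
        inv (F.act (fibreMap σ f η s s fun t ht => by rw [← fn_comp, ← w, ht])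
          (quasibijections_fibreMap hσ (MorphismProperty.id_mem _ S)
            ((Category.comp_id f).trans w) s s rfl _))) S.elems) ≫
      str.mul η hη ≫ F.act σ hσ

/-- Morphisms of `Q_n`-operads. -/
@[ext]
structure QOperad.Hom (A B : QOperad I V) where
  app : A.F ⟶ B.F
  isHom : A.str.IsHom B.str fun T => app.app (op (FreeGroupoid.mk ⟨T⟩))

instance : Category (QOperad I V) where
  Hom A B := QOperad.Hom A B
  id A := ⟨𝟙 A.F, OperadStr.IsHom.id A.str⟩
  comp f g := ⟨f.app ≫ g.app, f.isHom.comp g.isHom⟩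
  id_comp _ := QOperad.Hom.ext (Category.id_comp _)
  comp_id _ := QOperad.Hom.ext (Category.comp_id _)
  assoc _ _ _ := QOperad.Hom.ext (Category.assoc _ _ _)

variable (I V) in
/-- The family of objects underlying a `Q_n`-operad. -/
def QOperad.forget : QOperad I V ⥤ (NOrd I → V) where
  obj C := C.F.val
  map f := fun T => f.app.app (op (FreeGroupoid.mk ⟨T⟩))

variable (I V) in
/-- The family of objects underlying a quasisymmetric `n`-operad. -/
def QuasisymmetricOperad.forget : QuasisymmetricOperad I V ⥤ (NOrd I → V) where
  obj A := A.obj.X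
  map f := fun T => f.hom.app T

/-- `θ` identifies the `Q_n`-operad `C` with the restriction of the `n`-operad `A`: the unit and the
multiplications for order preserving maps are those of `A`, and quasibijections act as in `A`. -/
structure IsRestriction (A : NOperad I V) (C : QOperad I V) (θ : ∀ T, C.F.val T ≅ A.X T) :
    Prop where
  isHom : C.str.IsHom A.str.restrict fun T => (θ T).hom
  act_comp : ∀ {T S : NOrd I} (σ : T ⟶ S) (hσ : quasibijections I σ),
    C.F.act σ hσ ≫ (θ T).hom = (θ S).hom ≫ A.str.act σ hσ

/-- `θ` identifies the `n`-operad `A` with the extension of the `Q_n`-operad `C`: the unit is that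
of `C`, and the multiplication of `A` for a map `σ = π ≫ ν`, with a quasibijection `π : T ⟶ T'` and
an order preserving map `ν : T' ⟶ S`, is the composite
`C_S ⊗ ⨂_s C_{T_s} ⟶ C_S ⊗ ⨂_s C_{T'_s} ⟶ C_{T'} ⟶ C_T`
of the inverses of the actions of the restrictions `π_s : T_s ⟶ T'_s`, the multiplication for `ν`
and the action of `π`. -/
structure IsExtension (C : QOperad I V) (A : NOperad I V) (θ : ∀ T, A.X T ≅ C.F.val T) :
    Prop where
  e_comp : A.str.e ≫ (θ (unit I)).hom = C.str.e
  mul_comp : ∀ {T T' S : NOrd I} (σ : T ⟶ S) (π : T ⟶ T') (ν : T' ⟶ S)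
    (hπ : quasibijections I π) (hν : orderPreserving I ν) (w : σ = π ≫ ν),
    A.str.mul σ trivial ≫ (θ T).hom =
      ((θ S).hom ⊗ₘ tensHom (fun s => (θ (fibre σ s)).hom ≫
        inv (C.F.act (fibreMap π σ ν s s fun t ht => by rw [← fn_comp, ← w, ht])
          (quasibijections_fibreMap hπ (MorphismProperty.id_mem _ S)
            ((Category.comp_id σ).trans w) s s rfl _))) S.elems) ≫
      C.str.mul ν hν ≫ C.F.act π hπ

/-- `σ = π ≫ ν` with a quasibijection `π`, an order preserving map `ν`, and `π` preserving the total
order on the fibres of `σ`. -/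
structure IsFactorisation {T T' S : NOrd I} (σ : T ⟶ S) (π : T ⟶ T') (ν : T' ⟶ S) : Prop where
  quasibijection : quasibijections I π
  orderPreserving : orderPreserving I ν
  comp_eq : π ≫ ν = σ
  monotone_fibre : ∀ a b, fn σ a = fn σ b → a < b → fn π a < fn π b

end QOperads

end NOperads

end

open NOperads

/-! A quasisymmetric `n`-operad is determined by its multiplications for order preserving maps and
by the action of the quasibijections, since every map is a quasibijection followed by an order
preserving map. To factor `σ`, sort `T` lexicographically by `(σ a, a)`, copy the relations of `S`
between different fibres, and put all relations inside a fibre at the greatest level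
(`exists_isFactorisation`); a greatest level exists because `1 ≤ n`.

Inserting units into the associativity law of an `n`-operad gives two identities. If `f = π ≫ σ`
with `π` a quasibijection, then `m_σ` followed by `A(π)` is `m_f` preceded by the actions `A(π_s)`
on the fibres (`OperadStr.mul_comp_act`). If `f = σ ≫ ρ` with `ρ` a quasibijection, then `m_f` is
`m_σ` preceded by `A(ρ)` and a permutation of the fibres (`OperadStr.act_tensorHom_comp_mul`). The
first identity yields the second equivariance law and, when the `A(π_s)` are invertible, recovers
`m_σ` from the order preserving part; the two together yield the first equivariance law.

Conversely, a `Q_n`-operad is extended by the formula for `m_σ`, with a chosen factorisation. The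
second equivariance law says exactly that the choice is irrelevant (`QOperad.fibreMap_extMul`). The
two identities persist for the extension (`QOperad.extMul_comp_map`, and
`QOperad.map_tensorHom_comp_extMul` by the first equivariance law). They allow quasibijections to be
removed from a composable pair, so that associativity reduces to order preserving maps
(`QOperad.extAssoc`). Both constructions keep the underlying objects, hence all comparison
isomorphisms have identity components.

The bookkeeping of tensor factors rests on one coherence theorem, `Sym.unique`: a composite of
exchanges of neighbouring factors with different indices depends only on its source and target
lists. -/

noncomputable section

namespace NOperads

/-! ### Coherence for permutations of tensor factors. -/

section Coherence

variable {V : Type u} [Category.{v} V] [MonoidalCategory V]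

@[simp] lemma tens_nil {ι : Type} (X : ι → V) : tens X [] = 𝟙_ V := rfl

lemma tensHom_nil {ι : Type} {X Y : ι → V} (f : ∀ i, X i ⟶ Y i) : tensHom f [] = 𝟙 (𝟙_ V) := rfl

/-- The tensor product of morphisms, for the first factors and for the remaining ones. -/
def consHom {ι κ : Type} {X : ι → V} {Y : κ → V} {a : ι} {b : κ} {l : List ι} {l' : List κ}
    (p : X a ⟶ Y b) (f : tens X l ⟶ tens Y l') : tens X (a :: l) ⟶ tens Y (b :: l') :=
  p ⊗ₘ f

section consHom

variable {ι κ μ : Type} {X : ι → V} {Y : κ → V} {Z : μ → V} {a : ι} {b : κ} {c : μ} {l : List ι}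
  {l' : List κ} {l'' : List μ}

lemma consHom_comp (p : X a ⟶ Y b) (f : tens X l ⟶ tens Y l') (q : Y b ⟶ Z c)
    (g : tens Y l' ⟶ tens Z l'') : consHom p f ≫ consHom q g = consHom (p ≫ q) (f ≫ g) :=
  tensorHom_comp_tensorHom _ _ _ _

lemma consHom_comp_assoc (p : X a ⟶ Y b) (f : tens X l ⟶ tens Y l') (q : Y b ⟶ Z c)
    (g : tens Y l' ⟶ tens Z l'') {W : V} (h : tens Z (c :: l'') ⟶ W) :
    consHom p f ≫ consHom q g ≫ h = consHom (p ≫ q) (f ≫ g) ≫ h := by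
  rw [← Category.assoc, consHom_comp]

variable (X a l) in
@[simp] lemma consHom_id : consHom (𝟙 (X a)) (𝟙 (tens X l)) = 𝟙 (tens X (a :: l)) :=
  id_tensorHom_id _ _

end consHom

lemma tensHom_cons {ι : Type} {X Y : ι → V} (f : ∀ i, X i ⟶ Y i) (a : ι) (l : List ι) :
    tensHom f (a :: l) = consHom (f a) (tensHom f l) := rfl

instance isIso_tensHom {ι : Type} {X Y : ι → V} (f : ∀ i, X i ⟶ Y i) [∀ i, IsIso (f i)]
    (l : List ι) : IsIso (tensHom f l) := by
  induction l with
  | nil => exact inferInstanceAs (IsIso (𝟙 (𝟙_ V)))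
  | cons a l ih => exact inferInstanceAs (IsIso (f a ⊗ₘ tensHom f l))

variable [SymmetricCategory V]

/-- The exchange of the first two factors of `X ⊗ (Y ⊗ Z)`. -/
def swapHom (X Y Z : V) : X ⊗ (Y ⊗ Z) ⟶ Y ⊗ (X ⊗ Z) :=
  (α_ X Y Z).inv ≫ (β_ X Y).hom ▷ Z ≫ (α_ Y X Z).hom

@[simp] lemma swapHom_swapHom (X Y Z : V) : swapHom X Y Z ≫ swapHom Y X Z = 𝟙 _ := by
  simp [swapHom, ← comp_whiskerRight_assoc]

lemma swapHom_naturality {X Y Z X' Y' Z' : V} (f : X ⟶ X') (g : Y ⟶ Y') (h : Z ⟶ Z') :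
    (f ⊗ₘ (g ⊗ₘ h)) ≫ swapHom X' Y' Z' = swapHom X Y Z ≫ (g ⊗ₘ (f ⊗ₘ h)) := by
  simp only [swapHom, Category.assoc]
  rw [associator_inv_naturality_assoc, ← associator_naturality]
  simp only [← tensorHom_id, tensorHom_comp_tensorHom_assoc,
    BraidedCategory.braiding_naturality, Category.id_comp, Category.comp_id]

lemma swapHom_naturality_right (X Y : V) {Z Z' : V} (h : Z ⟶ Z') :
    X ◁ Y ◁ h ≫ swapHom X Y Z' = swapHom X Y Z ≫ Y ◁ X ◁ h := by
  simpa using swapHom_naturality (𝟙 X) (𝟙 Y) h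

/-- The Yang–Baxter equation for the braiding of `X`, `Y`, `Z`, with `W` as a spectator. It lets a
factor be pulled past an exchange of two others. -/
lemma swapHom_yangBaxter (X Y Z W : V) :
    swapHom X Y (Z ⊗ W) ≫ Y ◁ swapHom X Z W ≫ swapHom Y Z (X ⊗ W) =
      X ◁ swapHom Y Z W ≫ swapHom X Z (Y ⊗ W) ≫ Z ◁ swapHom X Y W := by
  have h := BraidedCategory.yang_baxter' X Y Z
  calc _ = 𝟙 _ ⊗≫ ((β_ X Y).hom ▷ Z ⊗≫ Y ◁ (β_ X Z).hom ⊗≫ (β_ Y Z).hom ▷ X) ▷ W ⊗≫ 𝟙 _ := by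
        unfold swapHom; monoidal
    _ = _ := by rw [h]; unfold swapHom; monoidal

lemma swapHom_unit (Z : V) : swapHom (𝟙_ V) (𝟙_ V) Z = 𝟙 _ := by
  have : (β_ (𝟙_ V) (𝟙_ V)).hom = 𝟙 _ := by
    rw [braiding_tensorUnit_left]; simp [unitors_equal]
  simp [swapHom, this]

/-- The exchange of the first two factors. -/
def swapHead {ι : Type} (X : ι → V) (a b : ι) (l : List ι) :
    tens X (a :: b :: l) ⟶ tens X (b :: a :: l) := swapHom (X a) (X b) (tens X l)

section swapHead

variable {ι : Type} (X : ι → V) (a b c : ι) (l : List ι)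

@[simp] lemma swapHead_swapHead : swapHead X a b l ≫ swapHead X b a l = 𝟙 _ :=
  swapHom_swapHom _ _ _

lemma swapHead_naturality {κ : Type} {X : ι → V} {Y : κ → V} {a b : ι} {a' b' : κ} {l : List ι}
    {l' : List κ} (p : X a ⟶ Y a') (q : X b ⟶ Y b') (h : tens X l ⟶ tens Y l') :
    consHom p (consHom q h) ≫ swapHead Y a' b' l' =
      swapHead X a b l ≫ consHom q (consHom p h) :=
  swapHom_naturality _ _ _

lemma swapHead_yangBaxter :
    swapHead X a b (c :: l) ≫ consHom (𝟙 (X b)) (swapHead X a c l) ≫ swapHead X b c (a :: l) =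
      consHom (𝟙 (X a)) (swapHead X b c l) ≫ swapHead X a c (b :: l) ≫
        consHom (𝟙 (X c)) (swapHead X a b l) := by
  have := swapHom_yangBaxter (X a) (X b) (X c) (tens X l)
  simp only [← id_tensorHom] at this
  exact this

end swapHead

/-! ### Structural symmetries -/

section Sym

variable {ι κ : Type}

/-- The morphisms between the tensor products along two lists that are composites of exchanges of
neighbouring factors with different indices. -/
inductive Sym (X : ι → V) : (l l' : List ι) → (tens X l ⟶ tens X l') → Prop
  | id (l : List ι) : Sym X l l (𝟙 _)
  | comp {l l' l'' : List ι} {f : tens X l ⟶ tens X l'} {g : tens X l' ⟶ tens X l''} :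
      Sym X l l' f → Sym X l' l'' g → Sym X l l'' (f ≫ g)
  | cons (a : ι) {l l' : List ι} {f : tens X l ⟶ tens X l'} :
      Sym X l l' f → Sym X (a :: l) (a :: l') (consHom (𝟙 (X a)) f)
  -- Without `a ≠ b` coherence would fail: the exchange of two factors with the same index has the
  -- same lists as the identity, but need not be the identity.
  | swap {a b : ι} (l : List ι) (h : a ≠ b) :
      Sym X (a :: b :: l) (b :: a :: l) (swapHead X a b l)

/-- The symmetries which move the first factor with index `a` to the front. -/
inductive Extract (X : ι → V) (a : ι) : (l l' : List ι) → (tens X l ⟶ tens X (a :: l')) → Prop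
  | head (l : List ι) : Extract X a (a :: l) l (𝟙 _)
  | tail {b : ι} {l l' : List ι} {f : tens X l ⟶ tens X (a :: l')} (h : b ≠ a) :
      Extract X a l l' f →
        Extract X a (b :: l) (b :: l') (consHom (𝟙 (X b)) f ≫ swapHead X b a l')

/-- The side condition in `tail` makes a derivation deterministic. The remaining lists have to be
identified before the two morphisms can be compared. -/
lemma Extract.unique {X : ι → V} {a : ι} {l m m' : List ι} {f : tens X l ⟶ tens X (a :: m)}
    {f' : tens X l ⟶ tens X (a :: m')} (h : Extract X a l m f) (h' : Extract X a l m' f') :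
    ∃ e : m = m', f ≫ eqToHom (by rw [e]) = f' := by
  induction h generalizing m' with
  | head l =>
    cases h' with
    | head => exact ⟨rfl, Category.comp_id _⟩
    | tail hb _ => exact absurd rfl hb
  | tail hb _ ih =>
    cases h' with
    | head => exact absurd rfl hb
    | tail _ h' =>
      obtain ⟨rfl, rfl⟩ := ih h'
      exact ⟨rfl, by simp⟩

lemma Sym.perm {X : ι → V} {l l' : List ι} {f : tens X l ⟶ tens X l'} (h : Sym X l l' f) :
    l.Perm l' := by
  induction h with
  | id => exact .refl _
  | comp _ _ h h' => exact h.trans h'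
  | cons a _ h => exact h.cons a
  | swap l _ => exact .swap _ _ l

/-- The inductive step of coherence: extracting `a` after a symmetry agrees with extracting `a`
before it and permuting the rest. Since exchanged indices differ, the first factor with index `a`
stays the first one throughout. -/
lemma Sym.extract {X : ι → V} {a : ι} {l l' m' : List ι} {f : tens X l ⟶ tens X l'}
    (h : Sym X l l' f) {g' : tens X l' ⟶ tens X (a :: m')} (h' : Extract X a l' m' g') :
    ∃ (m : List ι) (g : tens X l ⟶ tens X (a :: m)) (k : tens X m ⟶ tens X m'),
      Extract X a l m g ∧ Sym X m m' k ∧ f ≫ g' = g ≫ consHom (𝟙 (X a)) k := by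
  induction h generalizing m' with
  | id => exact ⟨_, _, _, h', .id _, by simp⟩
  | comp _ _ ih₁ ih₂ =>
    obtain ⟨m₂, g₂, k₂, hg₂, hk₂, e₂⟩ := ih₂ h'
    obtain ⟨m₁, g₁, k₁, hg₁, hk₁, e₁⟩ := ih₁ hg₂
    refine ⟨m₁, g₁, k₁ ≫ k₂, hg₁, hk₁.comp hk₂, ?_⟩
    rw [Category.assoc, e₂, reassoc_of% e₁, consHom_comp, Category.comp_id]
  | cons b h ih =>
    cases h' with
    | head => exact ⟨_, _, _, .head _, h, by simp⟩
    | tail hb h' =>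
      obtain ⟨m, g, k, hg, hk, e⟩ := ih h'
      refine ⟨_, _, _, .tail hb hg, hk.cons b, ?_⟩
      rw [consHom_comp_assoc, e, Category.assoc,
        ← swapHead_naturality (𝟙 (X b)) (𝟙 (X a)), consHom_comp_assoc]
  -- Three cases: `a = d`, where the extraction performs the swap itself; `a = c`, where the
  -- extraction undoes it because the category is symmetric; and `a` further back, which is
  -- Yang–Baxter.
  | @swap c d l hcd =>
    cases h' with
    | head => exact ⟨_, _, _, .tail hcd (.head l), .id _, by simp⟩
    | tail hd h' =>
      cases h' with
      | head => exact ⟨_, _, _, .head _, .id _, by simp⟩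
      | @tail _ _ l'' g hc h' =>
        refine ⟨_, _, _, .tail hc (.tail hd h'), .swap _ hcd, ?_⟩
        have e (b : ι) {l m m' : List ι} (f : tens X l ⟶ tens X m) (g : tens X m ⟶ tens X m') :
            consHom (𝟙 (X b)) (f ≫ g) = consHom (𝟙 (X b)) f ≫ consHom (𝟙 (X b)) g := by
          rw [consHom_comp, Category.comp_id]
        rw [e, e, Category.assoc, Category.assoc, Category.assoc,
          ← reassoc_of% (swapHead_naturality (𝟙 (X c)) (𝟙 (X d)) g),
          swapHead_yangBaxter]

lemma Sym.of_nil {X : ι → V} {l l' : List ι} {f : tens X l ⟶ tens X l'} (h : Sym X l l' f)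
    (hl : l = []) (hl' : l' = []) : f = eqToHom (by rw [hl, hl']) := by
  induction h with
  | id => rfl
  | comp h _ ih₁ ih₂ =>
    have := h.perm.symm.trans (.of_eq hl)
    rw [ih₁ hl this.eq_nil, ih₂ this.eq_nil hl', eqToHom_trans]
  | cons => simp at hl
  | swap => simp at hl

/-- Coherence: a structural symmetry is determined by the two lists. -/
theorem Sym.unique {X : ι → V} {l l' : List ι} {f g : tens X l ⟶ tens X l'} (hf : Sym X l l' f)
    (hg : Sym X l l' g) : f = g := by
  induction l' generalizing l with
  | nil => rw [hf.of_nil hf.perm.eq_nil rfl, hg.of_nil hf.perm.eq_nil rfl]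
  | cons a l' ih =>
    -- Extracting the head of the target list is the identity, so `f` itself splits as the
    -- extraction of `a` from `l` followed by a symmetry of the remaining factors, to which
    -- induction applies; likewise `g`.
    obtain ⟨m, p, k, hp, hk, e⟩ := hf.extract (.head l')
    obtain ⟨m', p', k', hp', hk', e'⟩ := hg.extract (.head l')
    obtain ⟨rfl, rfl⟩ := hp.unique hp'
    rw [ih hk hk', Category.comp_id] at e
    rw [Category.comp_id] at e'
    rw [e, e', eqToHom_refl, Category.comp_id]

lemma Sym.eqToHom {X : ι → V} {l l' : List ι} (h : l = l') :
    Sym X l l' (eqToHom (congrArg (tens X) h)) := by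
  subst h
  exact .id _

/-- Together with `Sym.tensPerm` this brings the symmetries used in the definition of operads under
the coherence theorem. -/
lemma Sym.tensExtract [DecidableEq ι] (X : ι → V) (a : ι) (l : List ι) (h : a ∈ l) :
    Sym X l (a :: l.erase a) (tensExtract X a l h).hom := by
  induction l with
  | nil => exact absurd h List.not_mem_nil
  | cons b l ih =>
    by_cases hab : b = a
    · subst hab
      unfold NOperads.tensExtract
      simp only [dite_true, eqToIso.hom]
      exact .eqToHom (by rw [List.erase_cons_head])
    · have h' : a ∈ l := (List.mem_cons.1 h).resolve_left fun h => hab h.symm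
      have key := (((ih h').cons b).comp (.swap (l.erase a) hab)).comp (.eqToHom (X := X)
        (show a :: b :: l.erase a = a :: (b :: l).erase a by
          rw [List.erase_cons_tail (by simpa using hab)]))
      unfold NOperads.tensExtract
      simp only [hab, dite_false]
      refine Eq.mp (congrArg (Sym X (b :: l) (a :: (b :: l).erase a)) (Eq.symm ?_)) key
      have aux {A B K M W : V} (f : K ⟶ A ⊗ M) (e : A ⊗ (B ⊗ M) ⟶ W) :
          B ◁ f ≫ (α_ B A M).inv ≫ (β_ B A).hom ▷ M ≫ (α_ A B M).hom ≫ e =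
            ((𝟙 B ⊗ₘ f) ≫ swapHom B A M) ≫ e := by simp [swapHom]
      exact aux _ _

lemma Sym.tensPerm [DecidableEq ι] (X : ι → V) (l l' : List ι) (h : l.Perm l') :
    Sym X l l' (tensPerm X l l' h).hom := by
  induction l' generalizing l with
  | nil => exact .eqToHom h.eq_nil
  | cons b l' ih =>
    have := (Sym.tensExtract X b l (h.mem_iff.2 List.mem_cons_self)).comp ((ih _ (by
        have := h.erase b
        rwa [List.erase_cons_head] at this)).cons b)
    rw [consHom, id_tensorHom] at this
    exact this

lemma Sym.eq_tensPerm [DecidableEq ι] {X : ι → V} {l l' : List ι} {f : tens X l ⟶ tens X l'}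
    (hf : Sym X l l' f) : f = (NOperads.tensPerm X l l' hf.perm).hom :=
  hf.unique (.tensPerm X l l' _)

/-- The morphism `g` performs the same exchanges on `Y`. Only its being a `Sym` is recorded, because
coherence then identifies it; the existential statements below follow the same pattern. -/
lemma Sym.naturality {X Y : ι → V} {l l' : List ι} {f : tens X l ⟶ tens X l'} (hf : Sym X l l' f)
    (φ : ∀ i, X i ⟶ Y i) :
    ∃ g, Sym Y l l' g ∧ f ≫ tensHom φ l' = tensHom φ l ≫ g := by
  induction hf with
  | id => exact ⟨_, .id _, by simp⟩
  | comp _ _ ih₁ ih₂ =>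
    obtain ⟨g₁, h₁, e₁⟩ := ih₁
    obtain ⟨g₂, h₂, e₂⟩ := ih₂
    exact ⟨_, h₁.comp h₂, by rw [Category.assoc, e₂, reassoc_of% e₁]⟩
  | cons a _ ih =>
    obtain ⟨g, h, e⟩ := ih
    exact ⟨_, h.cons a, by simp [tensHom_cons, consHom_comp, e]⟩
  | swap l h => exact ⟨_, .swap l h, (swapHead_naturality _ _ _).symm⟩

lemma tensPerm_naturality [DecidableEq ι] {X Y : ι → V} (φ : ∀ i, X i ⟶ Y i) (l l' : List ι)
    (h : l.Perm l') :
    (tensPerm X l l' h).hom ≫ tensHom φ l' = tensHom φ l ≫ (tensPerm Y l l' h).hom := by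
  obtain ⟨g, hg, e⟩ := (Sym.tensPerm X l l' h).naturality φ
  rw [e, hg.eq_tensPerm]

end Sym

end Coherence
-- Coherence for reindexing, concatenation and grouping of factors.
section Coherence

variable {V : Type u} [Category.{v} V] [MonoidalCategory V]

section

variable {ι κ μ : Type}

lemma tensMap_cons (X : ι → V) (g : κ → ι) (a : κ) (l : List κ) :
    (tensMap X g (a :: l)).hom = consHom (X := X) (Y := fun j => X (g j)) (a := g a) (b := a)
      (𝟙 (X (g a))) (tensMap X g l).hom :=
  (id_tensorHom _ _).symm

lemma tensMap_naturality {X Y : ι → V} (φ : ∀ i, X i ⟶ Y i) (g : κ → ι) (l : List κ) :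
    tensHom φ (l.map g) ≫ (tensMap Y g l).hom =
      (tensMap X g l).hom ≫ tensHom (fun j => φ (g j)) l := by
  induction l with
  | nil => rfl
  | cons a l ih =>
    rw [tensMap_cons, tensMap_cons, tensHom_cons]
    change consHom _ _ ≫ consHom _ _ = _
    rw [consHom_comp, consHom_comp, ih, Category.id_comp, Category.comp_id]

lemma tensAppend_naturality {X Y : ι → V} (φ : ∀ i, X i ⟶ Y i) (l l' : List ι) :
    tensHom φ (l ++ l') ≫ (tensAppend Y l l').hom =
      (tensAppend X l l').hom ≫ (tensHom φ l ⊗ₘ tensHom φ l') := by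
  induction l with
  | nil =>
    -- Tensor products along `[]` and `a :: l` are units and binary tensor products only by
    -- unfolding `tens`. The identity is therefore proved for arbitrary objects and matched by
    -- definitional equality, here and in the later `aux`.
    have aux {A B : V} (f : A ⟶ B) : f ≫ (λ_ B).inv = (λ_ A).inv ≫ (𝟙 (𝟙_ V) ⊗ₘ f) := by simp
    exact aux _
  | cons a l ih =>
    have aux {A A' B B' C C' D D' : V} {f : A ⟶ A'} {k : B ⟶ B'} {T : B ⟶ C ⊗ D} {T' : B' ⟶ C' ⊗ D'}
        {c : C ⟶ C'} {d : D ⟶ D'} (h : k ≫ T' = T ≫ (c ⊗ₘ d)) :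
        (f ⊗ₘ k) ≫ A' ◁ T' ≫ (α_ A' C' D').inv =
          (A ◁ T ≫ (α_ A C D).inv) ≫ ((f ⊗ₘ c) ⊗ₘ d) := by
      rw [Category.assoc, ← associator_inv_naturality, ← id_tensorHom, ← id_tensorHom,
        tensorHom_comp_tensorHom_assoc, h, tensorHom_comp_tensorHom_assoc, Category.id_comp,
        Category.comp_id]
    exact aux ih

lemma tensFlatMap_naturality {X Y : ι → V} (φ : ∀ i, X i ⟶ Y i) (g : κ → List ι) (l : List κ) :
    tensHom φ (l.flatMap g) ≫ (tensFlatMap Y g l).hom =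
      (tensFlatMap X g l).hom ≫ tensHom (fun r => tensHom φ (g r)) l := by
  induction l with
  | nil => rfl
  | cons r l ih =>
    have aux {A B C A' B' C' D D' : V} {k : D ⟶ D'} {T : D ⟶ A ⊗ B} {T' : D' ⟶ A' ⊗ B'}
        {a : A ⟶ A'} {b : B ⟶ B'} {c : C ⟶ C'} {G : B ⟶ C} {G' : B' ⟶ C'}
        (h₁ : k ≫ T' = T ≫ (a ⊗ₘ b)) (h₂ : b ≫ G' = G ≫ c) :
        k ≫ T' ≫ A' ◁ G' = (T ≫ A ◁ G) ≫ (a ⊗ₘ c) := by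
      rw [reassoc_of% h₁, Category.assoc, ← id_tensorHom, ← id_tensorHom,
        tensorHom_comp_tensorHom, tensorHom_comp_tensorHom, h₂, Category.id_comp, Category.comp_id]
    exact aux (tensAppend_naturality φ (g r) (l.flatMap g)) ih

end

lemma tensUnit_map {ι κ : Type} (g : κ → ι) (l : List κ) :
    tensUnit (V := V) (l.map g) ≫ (tensMap (fun _ => 𝟙_ V) g l).hom = tensUnit l := by
  induction l with
  | nil => exact Category.comp_id _
  | cons a l ih =>
    have aux {A B : V} {t : 𝟙_ V ⟶ A} {t' : 𝟙_ V ⟶ B} {f : A ⟶ B} (h : t ≫ f = t') :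
        ((λ_ (𝟙_ V)).inv ≫ 𝟙_ V ◁ t) ≫ 𝟙_ V ◁ f = (λ_ (𝟙_ V)).inv ≫ 𝟙_ V ◁ t' := by
      simp [← h]
    exact aux ih

lemma tensUnit_append {ι : Type} (l l' : List ι) :
    tensUnit (V := V) (l ++ l') ≫ (tensAppend (fun _ => 𝟙_ V) l l').hom =
      (λ_ (𝟙_ V)).inv ≫ (tensUnit l ⊗ₘ tensUnit l') := by
  induction l with
  | nil =>
    have aux {A : V} (t : 𝟙_ V ⟶ A) :
        t ≫ (λ_ A).inv = (λ_ (𝟙_ V)).inv ≫ (𝟙 (𝟙_ V) ⊗ₘ t) := by simp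
    exact aux _
  | cons a l ih =>
    have aux {A B C : V} {t : 𝟙_ V ⟶ A} {T : A ⟶ B ⊗ C} {b : 𝟙_ V ⟶ B} {c : 𝟙_ V ⟶ C}
        (h : t ≫ T = (λ_ (𝟙_ V)).inv ≫ (b ⊗ₘ c)) :
        ((λ_ (𝟙_ V)).inv ≫ 𝟙_ V ◁ t) ≫ 𝟙_ V ◁ T ≫ (α_ (𝟙_ V) B C).inv =
          (λ_ (𝟙_ V)).inv ≫ (((λ_ (𝟙_ V)).inv ≫ 𝟙_ V ◁ b) ⊗ₘ c) := by
      have h' : (λ_ (𝟙_ V)).inv ≫ (((λ_ (𝟙_ V)).inv ≫ 𝟙_ V ◁ b) ⊗ₘ c) =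
          (λ_ (𝟙_ V)).inv ≫ ((λ_ (𝟙_ V)).inv ▷ 𝟙_ V) ≫ (α_ _ _ _).hom ≫ (𝟙 (𝟙_ V) ⊗ₘ (b ⊗ₘ c)) ≫
            (α_ _ _ _).inv := by
        rw [associator_inv_naturality, Iso.hom_inv_id_assoc, ← tensorHom_id,
          tensorHom_comp_tensorHom, Category.id_comp, id_tensorHom]
      rw [Category.assoc, ← whiskerLeft_comp_assoc, h, h', id_tensorHom,
        MonoidalCategory.whiskerLeft_comp]
      simp only [← Category.assoc]
      congr 2
      simp [unitors_inv_equal]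
    exact aux ih

lemma comp_tensorHom_comp_tensorHom {A A' A'' B B' B'' A₁ B₁ D D' : V} {T₁ : D ⟶ A ⊗ B}
    {T₃ : D' ⟶ A' ⊗ B'} {x : A ⟶ A₁} {y : B ⟶ B₁} {a : A₁ ⟶ A''} {g : B₁ ⟶ B''} {s₂ : A ⟶ A'}
    {a' : A' ⟶ A''} {s : B ⟶ B'} {g' : B' ⟶ B''} {s₃ : D ⟶ D'} (e₂ : x ≫ a = s₂ ≫ a')
    (e : y ≫ g = s ≫ g') (e₃ : s₃ ≫ T₃ = T₁ ≫ (s₂ ⊗ₘ s)) :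
    (T₁ ≫ (x ⊗ₘ y)) ≫ (a ⊗ₘ g) = s₃ ≫ T₃ ≫ (a' ⊗ₘ g') := by
  rw [reassoc_of% e₃, Category.assoc, tensorHom_comp_tensorHom, tensorHom_comp_tensorHom, e, e₂]

/-- The tensor product along a concatenation of images of lists, as a tensor product of tensor
products. -/
def tensGroup {ι ρ : Type} (Y : ι → V) {κ : ρ → Type} (h : ∀ r, κ r → ι) (k : ∀ r, List (κ r))
    (L : List ρ) : tens Y (L.flatMap fun r => (k r).map (h r)) ⟶
      tens (fun r => tens (fun j => Y (h r j)) (k r)) L :=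
  (tensFlatMap Y (fun r => (k r).map (h r)) L).hom ≫
    tensHom (fun r => (tensMap Y (h r) (k r)).hom) L

/-- The tensor product of a single factor. -/
def tensSingle {ι : Type} (X : ι → V) {l : List ι} (j : ι) (h : [j] = l) : tens X l ⟶ X j :=
  eqToHom (congrArg (tens X) h.symm) ≫ (ρ_ (X j)).hom

lemma tensSingle_rfl {ι : Type} (X : ι → V) (j : ι) :
    tensSingle X j rfl = (ρ_ (X j)).hom := Category.id_comp _

lemma tensSingle_naturality {ι : Type} {X Y : ι → V} (φ : ∀ i, X i ⟶ Y i) {l : List ι} (j : ι)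
    (h : [j] = l) : tensHom φ l ≫ tensSingle Y j h = tensSingle X j h ≫ φ j := by
  subst h
  rw [tensSingle_rfl, tensSingle_rfl]
  have aux {A B : V} (f : A ⟶ B) : (f ⊗ₘ 𝟙 (𝟙_ V)) ≫ (ρ_ B).hom = (ρ_ A).hom ≫ f := by simp
  exact aux _

section tensGroup

variable {ι ι' ρ : Type} {κ : ρ → Type}

lemma tensGroup_cons (Y : ι → V) (h : ∀ r, κ r → ι) (k : ∀ r, List (κ r)) (r : ρ) (L : List ρ) :
    tensGroup Y h k (r :: L) =
      (tensAppend Y ((k r).map (h r)) (L.flatMap fun r => (k r).map (h r))).hom ≫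
        ((tensMap Y (h r) (k r)).hom ⊗ₘ tensGroup Y h k L) := by
  have aux {A B C D A' C' : V} (T : D ⟶ A ⊗ B) (G : B ⟶ C) (a : A ⟶ A') (c : C ⟶ C') :
      (T ≫ A ◁ G) ≫ (a ⊗ₘ c) = T ≫ (a ⊗ₘ (G ≫ c)) := by
    rw [Category.assoc, ← id_tensorHom, tensorHom_comp_tensorHom, Category.id_comp]
  exact aux _ _ _ _

lemma tensGroup_naturality {X Y : ι → V} (φ : ∀ i, X i ⟶ Y i) (h : ∀ r, κ r → ι)
    (k : ∀ r, List (κ r)) (L : List ρ) :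
    tensHom φ _ ≫ tensGroup Y h k L =
      tensGroup X h k L ≫ tensHom (fun r => tensHom (fun j => φ (h r j)) (k r)) L := by
  rw [tensGroup, tensGroup, reassoc_of% (tensFlatMap_naturality φ), Category.assoc,
    ← tensHom_comp, ← tensHom_comp]
  simp only [tensMap_naturality]

lemma tensUnit_tensGroup (h : ∀ r, κ r → ι) (k : ∀ r, List (κ r)) (L : List ρ) :
    tensUnit (V := V) (L.flatMap fun r => (k r).map (h r)) ≫ tensGroup (fun _ => 𝟙_ V) h k L =
      tensUnit L ≫ tensHom (fun r => tensUnit (k r)) L := by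
  induction L with
  | nil => simp [tensGroup, tensHom_nil]; rfl
  | cons r L ih =>
    rw [tensGroup_cons]
    have aux {A B C D U W : V} {a : 𝟙_ V ⟶ A} {b : 𝟙_ V ⟶ B} {T : U ⟶ A ⊗ B} {u : 𝟙_ V ⟶ U}
        {f : A ⟶ C} {g : B ⟶ D} {c : 𝟙_ V ⟶ C} {w : 𝟙_ V ⟶ W} {d : W ⟶ D}
        (h : u ≫ T = (λ_ (𝟙_ V)).inv ≫ (a ⊗ₘ b)) (h₁ : a ≫ f = c) (h₂ : b ≫ g = w ≫ d) :
        u ≫ T ≫ (f ⊗ₘ g) = ((λ_ (𝟙_ V)).inv ≫ 𝟙_ V ◁ w) ≫ (c ⊗ₘ d) := by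
      rw [reassoc_of% h, tensorHom_comp_tensorHom, h₁, h₂]
      simp [MonoidalCategory.tensorHom_def']
    exact aux (tensUnit_append _ _) (tensUnit_map _ _) ih

end tensGroup

variable [SymmetricCategory V]

section

variable {ι κ μ : Type}

/-- Injectivity of `g` keeps the indices of exchanged factors different. -/
lemma Sym.map {X : ι → V} {g : κ → ι} (hg : Function.Injective g) {l l' : List κ}
    {f : tens (fun j => X (g j)) l ⟶ tens (fun j => X (g j)) l'}
    (hf : Sym (fun j => X (g j)) l l' f) :
    ∃ k, Sym X (l.map g) (l'.map g) k ∧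
      k ≫ (tensMap X g l').hom = (tensMap X g l).hom ≫ f := by
  induction hf with
  | id => exact ⟨_, .id _, by simp⟩
  | comp _ _ ih₁ ih₂ =>
    obtain ⟨g₁, h₁, e₁⟩ := ih₁
    obtain ⟨g₂, h₂, e₂⟩ := ih₂
    exact ⟨_, h₁.comp h₂, by rw [Category.assoc, e₂, reassoc_of% e₁]⟩
  | cons a _ ih =>
    obtain ⟨k, h, e⟩ := ih
    refine ⟨_, h.cons (g a), ?_⟩
    rw [tensMap_cons, tensMap_cons]
    change consHom _ _ ≫ consHom _ _ = consHom _ _ ≫ consHom _ _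
    rw [consHom_comp, consHom_comp, e]
  | @swap a b l h =>
    refine ⟨_, .swap _ (hg.ne h), ?_⟩
    rw [tensMap_cons, tensMap_cons, tensMap_cons, tensMap_cons]
    exact (swapHead_naturality _ _ _).symm

lemma Sym.append_right {X : ι → V} (m : List ι) {l l' : List ι} {f : tens X l ⟶ tens X l'}
    (hf : Sym X l l' f) :
    ∃ k, Sym X (m ++ l) (m ++ l') k ∧
      k ≫ (tensAppend X m l').hom = (tensAppend X m l).hom ≫ (𝟙 _ ⊗ₘ f) := by
  induction m with
  | nil =>
    have aux {A B : V} (f : A ⟶ B) : f ≫ (λ_ B).inv = (λ_ A).inv ≫ (𝟙 (𝟙_ V) ⊗ₘ f) := by simp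
    exact ⟨f, hf, aux f⟩
  | cons a m ih =>
    obtain ⟨k, h, e⟩ := ih
    have aux {A B B' C D D' : V} {k : B ⟶ B'} {T : B ⟶ C ⊗ D} {T' : B' ⟶ C ⊗ D'}
        {d : D ⟶ D'} (h : k ≫ T' = T ≫ (𝟙 C ⊗ₘ d)) :
        (𝟙 A ⊗ₘ k) ≫ A ◁ T' ≫ (α_ A C D').inv =
          (A ◁ T ≫ (α_ A C D).inv) ≫ (𝟙 (A ⊗ C) ⊗ₘ d) := by
      rw [Category.assoc, ← id_tensorHom_id, ← associator_inv_naturality, ← id_tensorHom,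
        ← id_tensorHom, tensorHom_comp_tensorHom_assoc, h, tensorHom_comp_tensorHom_assoc]
    exact ⟨_, h.cons a, aux e⟩

lemma Sym.append_left {X : ι → V} (m : List ι) {l l' : List ι} {f : tens X l ⟶ tens X l'}
    (hf : Sym X l l' f) :
    ∃ k, Sym X (l ++ m) (l' ++ m) k ∧
      k ≫ (tensAppend X l' m).hom = (tensAppend X l m).hom ≫ (f ⊗ₘ 𝟙 _) := by
  induction hf with
  | id => exact ⟨_, .id _, by simp⟩
  | comp _ _ ih₁ ih₂ =>
    obtain ⟨g₁, h₁, e₁⟩ := ih₁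
    obtain ⟨g₂, h₂, e₂⟩ := ih₂
    refine ⟨_, h₁.comp h₂, ?_⟩
    rw [Category.assoc, e₂, reassoc_of% e₁, tensorHom_comp_tensorHom, Category.comp_id]
  | cons a _ ih =>
    obtain ⟨k, h, e⟩ := ih
    have aux {A B B' C C' D : V} {k : B ⟶ B'} {T : B ⟶ C ⊗ D} {T' : B' ⟶ C' ⊗ D}
        {c : C ⟶ C'} (h : k ≫ T' = T ≫ (c ⊗ₘ 𝟙 D)) :
        (𝟙 A ⊗ₘ k) ≫ A ◁ T' ≫ (α_ A C' D).inv =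
          (A ◁ T ≫ (α_ A C D).inv) ≫ ((𝟙 A ⊗ₘ c) ⊗ₘ 𝟙 D) := by
      rw [Category.assoc, ← associator_inv_naturality, ← id_tensorHom, ← id_tensorHom,
        tensorHom_comp_tensorHom_assoc, h, tensorHom_comp_tensorHom_assoc]
    exact ⟨_, h.cons a, aux e⟩
  | @swap a b l h =>
    have aux {A B K L M : V} (T : K ⟶ L ⊗ M) :
        swapHom A B K ≫ B ◁ (A ◁ T ≫ (α_ A L M).inv) ≫ (α_ B (A ⊗ L) M).inv =
          (A ◁ (B ◁ T ≫ (α_ B L M).inv) ≫ (α_ A (B ⊗ L) M).inv) ≫ (swapHom A B L ⊗ₘ 𝟙 M) := by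
      rw [tensorHom_id, MonoidalCategory.whiskerLeft_comp, Category.assoc,
        ← reassoc_of% (swapHom_naturality_right A B T), MonoidalCategory.whiskerLeft_comp,
        Category.assoc, Category.assoc]
      congr 1
      simp [swapHom]
    exact ⟨_, .swap _ h, aux _⟩

lemma Sym.append {X : ι → V} {l l' m m' : List ι} {f : tens X l ⟶ tens X l'}
    {g : tens X m ⟶ tens X m'} (hf : Sym X l l' f) (hg : Sym X m m' g) :
    ∃ k, Sym X (l ++ m) (l' ++ m') k ∧
      k ≫ (tensAppend X l' m').hom = (tensAppend X l m).hom ≫ (f ⊗ₘ g) := by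
  obtain ⟨k₁, h₁, e₁⟩ := hf.append_left m
  obtain ⟨k₂, h₂, e₂⟩ := hg.append_right l'
  refine ⟨_, h₁.comp h₂, ?_⟩
  rw [Category.assoc, e₂, reassoc_of% e₁, tensorHom_comp_tensorHom, Category.comp_id,
    Category.id_comp]

/-- The two mapped lists are equal, but not definitionally. Treating the comparison as a `Sym`
avoids casts and lets it be absorbed by coherence. -/
lemma exists_sym_tensMap_map (X : ι → V) (g : κ → ι) (p : μ → κ) (l : List μ) :
    ∃ k, Sym X ((l.map p).map g) (l.map fun j => g (p j)) k ∧
      (tensMap X g (l.map p)).hom ≫ (tensMap (fun j => X (g j)) p l).hom =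
        k ≫ (tensMap X (fun j => g (p j)) l).hom := by
  induction l with
  | nil => exact ⟨_, .id _, rfl⟩
  | cons a l ih =>
    obtain ⟨k, h, e⟩ := ih
    refine ⟨_, h.cons _, ?_⟩
    rw [tensMap_cons, tensMap_cons]
    refine (congrArg (· ≫ consHom _ _) (tensMap_cons X g (p a) (l.map p))).trans ?_
    change consHom _ _ ≫ consHom _ _ = consHom _ _ ≫ consHom _ _
    rw [consHom_comp, consHom_comp, e]

lemma exists_sym_tensMap_append (X : ι → V) (g : κ → ι) (l l' : List κ) :
    ∃ k, Sym X ((l ++ l').map g) (l.map g ++ l'.map g) k ∧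
      (tensMap X g (l ++ l')).hom ≫ (tensAppend (fun j => X (g j)) l l').hom =
        k ≫ (tensAppend X (l.map g) (l'.map g)).hom ≫
          ((tensMap X g l).hom ⊗ₘ (tensMap X g l').hom) := by
  induction l with
  | nil =>
    have aux {A B : V} (f : A ⟶ B) : f ≫ (λ_ B).inv = 𝟙 A ≫ (λ_ A).inv ≫ (𝟙 (𝟙_ V) ⊗ₘ f) := by
      simp
    exact ⟨_, .id _, aux _⟩
  | cons a l ih =>
    obtain ⟨k, h, e⟩ := ih
    have aux {A B B₁ B₂ C C' D D' : V} {k : B ⟶ B₁} {t : B ⟶ B₂} {T : B₂ ⟶ C ⊗ D}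
        {T' : B₁ ⟶ C' ⊗ D'} {c : C' ⟶ C} {d : D' ⟶ D} (h : t ≫ T = k ≫ T' ≫ (c ⊗ₘ d)) :
        A ◁ t ≫ A ◁ T ≫ (α_ A C D).inv =
          (𝟙 A ⊗ₘ k) ≫ (A ◁ T' ≫ (α_ A C' D').inv) ≫ (A ◁ c ⊗ₘ d) := by
      rw [← whiskerLeft_comp_assoc, h, Category.assoc, ← id_tensorHom A c,
        ← associator_inv_naturality]
      simp
    exact ⟨_, h.cons _, aux e⟩

/-- Units may be permuted freely because the braiding of the unit object with itself is the
identity. -/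
lemma Sym.tensUnit {l l' : List ι} {f : tens (fun _ : ι => 𝟙_ V) l ⟶ tens (fun _ => 𝟙_ V) l'}
    (hf : Sym (fun _ : ι => 𝟙_ V) l l' f) : tensUnit l ≫ f = tensUnit l' := by
  induction hf with
  | id => simp
  | comp _ _ ih₁ ih₂ => rw [reassoc_of% ih₁, ih₂]
  | cons a _ ih =>
    have aux {A B : V} {t : 𝟙_ V ⟶ A} {t' : 𝟙_ V ⟶ B} {f : A ⟶ B} (h : t ≫ f = t') :
        ((λ_ (𝟙_ V)).inv ≫ 𝟙_ V ◁ t) ≫ (𝟙 (𝟙_ V) ⊗ₘ f) = (λ_ (𝟙_ V)).inv ≫ 𝟙_ V ◁ t' := by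
      simp [← h]
    exact aux ih
  | swap l h =>
    have aux {A B : V} (t : B ⟶ 𝟙_ V ⊗ 𝟙_ V ⊗ A) : t ≫ swapHom (𝟙_ V) (𝟙_ V) A = t := by
      rw [swapHom_unit, Category.comp_id]
    exact aux _

end

section Group

variable {ι ι' ρ : Type} {κ κ' : ρ → Type}

lemma exists_sym_tensMap_tensGroup (Y : ι' → V) (π : ι → ι') (h : ∀ r, κ r → ι)
    (k : ∀ r, List (κ r)) (L : List ρ) :
    ∃ s, Sym Y ((L.flatMap fun r => (k r).map (h r)).map π)
        (L.flatMap fun r => (k r).map fun j => π (h r j)) s ∧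
      (tensMap Y π _).hom ≫ tensGroup (fun i => Y (π i)) h k L =
        s ≫ tensGroup Y (fun r j => π (h r j)) k L := by
  induction L with
  | nil => exact ⟨_, .id _, rfl⟩
  | cons r L ih =>
    obtain ⟨s, hs, e⟩ := ih
    obtain ⟨s₁, hs₁, e₁⟩ :=
      exists_sym_tensMap_append Y π ((k r).map (h r)) (L.flatMap fun r => (k r).map (h r))
    obtain ⟨s₂, hs₂, e₂⟩ := exists_sym_tensMap_map Y π (h r) (k r)
    obtain ⟨s₃, hs₃, e₃⟩ := hs₂.append hs
    refine ⟨_, hs₁.comp hs₃, ?_⟩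
    rw [tensGroup_cons, tensGroup_cons]
    have aux {D D' D'' A B A' B' : V} {m : D ⟶ D'} {T : D' ⟶ A ⊗ B} {t : D ⟶ D''}
        {T' : D'' ⟶ A ⊗ B} (h : m ≫ T = t ≫ T') (f : A ⊗ B ⟶ A' ⊗ B') :
        m ≫ T ≫ f = t ≫ T' ≫ f := by rw [reassoc_of% h]
    refine ((aux e₁ _).trans (congrArg (s₁ ≫ ·) ?_)).trans (Category.assoc _ _ _).symm
    exact comp_tensorHom_comp_tensorHom e₂ e e₃

lemma exists_sym_tensGroup_tensMap (Y : ι → V) (h : ∀ r, κ' r → ι) (p : ∀ r, κ r → κ' r)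
    (k : ∀ r, List (κ r)) (L : List ρ) :
    ∃ s, Sym Y (L.flatMap fun r => ((k r).map (p r)).map (h r))
        (L.flatMap fun r => (k r).map fun j => h r (p r j)) s ∧
      tensGroup Y h (fun r => (k r).map (p r)) L ≫
          tensHom (fun r => (tensMap (fun j => Y (h r j)) (p r) (k r)).hom) L =
        s ≫ tensGroup Y (fun r j => h r (p r j)) k L := by
  induction L with
  | nil => exact ⟨_, .id _, by simp [tensGroup, tensHom_nil]; rfl⟩
  | cons r L ih =>
    obtain ⟨s, hs, e⟩ := ih
    obtain ⟨s₂, hs₂, e₂⟩ := exists_sym_tensMap_map Y (h r) (p r) (k r)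
    obtain ⟨s₃, hs₃, e₃⟩ := hs₂.append hs
    refine ⟨_, hs₃, ?_⟩
    rw [tensGroup_cons, tensGroup_cons]
    exact comp_tensorHom_comp_tensorHom e₂ e e₃

lemma exists_sym_tensGroup_sym (Y : ι → V) (h : ∀ r, κ r → ι) (hh : ∀ r, Function.Injective (h r))
    (k k' : ∀ r, List (κ r))
    (f : ∀ r, tens (fun j => Y (h r j)) (k r) ⟶ tens (fun j => Y (h r j)) (k' r))
    (hf : ∀ r, Sym (fun j => Y (h r j)) (k r) (k' r) (f r)) (L : List ρ) :
    ∃ s, Sym Y (L.flatMap fun r => (k r).map (h r)) (L.flatMap fun r => (k' r).map (h r)) s ∧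
      tensGroup Y h k L ≫ tensHom f L = s ≫ tensGroup Y h k' L := by
  induction L with
  | nil => exact ⟨_, .id _, by simp [tensGroup, tensHom_nil]; rfl⟩
  | cons r L ih =>
    obtain ⟨s, hs, e⟩ := ih
    obtain ⟨s₂, hs₂, e₂⟩ := (hf r).map (hh r)
    obtain ⟨s₃, hs₃, e₃⟩ := hs₂.append hs
    refine ⟨_, hs₃, ?_⟩
    rw [tensGroup_cons, tensGroup_cons]
    exact comp_tensorHom_comp_tensorHom e₂.symm e e₃

lemma exists_sym_tensGroup_eqToHom (Y : ι → V) (h h' : ∀ r, κ r → ι) (k : ∀ r, List (κ r))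
    (e : ∀ r j, h r j = h' r j) (L : List ρ) :
    ∃ s, Sym Y (L.flatMap fun r => (k r).map (h r)) (L.flatMap fun r => (k r).map (h' r)) s ∧
      tensGroup Y h k L ≫
          tensHom (fun r => tensHom (fun j => eqToHom (congrArg Y (e r j))) (k r)) L =
        s ≫ tensGroup Y h' k L := by
  obtain rfl : h = h' := funext fun r => funext (e r)
  exact ⟨_, .id _, by simp [tensHom_id]⟩

/-- Compatibility of the grouping of factors with a reindexing `π` that restricts to reindexings
`p r` of the groups. -/
theorem tensPerm_tensMap_tensGroup [DecidableEq ι] [DecidableEq ι'] [∀ r, DecidableEq (κ' r)]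
    (Y : ι' → V) {π : ι → ι'} (hπ : Function.Injective π) {h : ∀ r, κ r → ι} {h' : ∀ r, κ' r → ι'}
    (hh' : ∀ r, Function.Injective (h' r)) {p : ∀ r, κ r → κ' r}
    (comm : ∀ r j, h' r (p r j) = π (h r j)) {l : List ι} {l' : List ι'} {k : ∀ r, List (κ r)}
    {k' : ∀ r, List (κ' r)} {L : List ρ} (h₁ : l'.Perm (l.map π))
    (h₂ : l.Perm (L.flatMap fun r => (k r).map (h r)))
    (h₃ : l'.Perm (L.flatMap fun r => (k' r).map (h' r)))
    (h₄ : ∀ r, (k' r).Perm ((k r).map (p r))) :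
    (tensPerm Y l' (l.map π) h₁).hom ≫ (tensMap Y π l).hom ≫
        (tensPerm (fun i => Y (π i)) l _ h₂).hom ≫ tensGroup (fun i => Y (π i)) h k L =
      (tensPerm Y l' _ h₃).hom ≫ tensGroup Y h' k' L ≫
        tensHom (fun r => (tensPerm (fun j => Y (h' r j)) (k' r) _ (h₄ r)).hom ≫
          (tensMap (fun j => Y (h' r j)) (p r) (k r)).hom ≫
          tensHom (fun j => eqToHom (congrArg Y (comm r j))) (k r)) L := by
  obtain ⟨s₁, hs₁, e₁⟩ := (Sym.tensPerm (fun i => Y (π i)) l _ h₂).map hπ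
  obtain ⟨s₂, hs₂, e₂⟩ := exists_sym_tensMap_tensGroup Y π h k L
  obtain ⟨s₃, hs₃, e₃⟩ := exists_sym_tensGroup_sym Y h' hh' k' (fun r => (k r).map (p r))
    (fun r => (tensPerm (fun j => Y (h' r j)) (k' r) _ (h₄ r)).hom) (fun r => .tensPerm _ _ _ _) L
  obtain ⟨s₄, hs₄, e₄⟩ := exists_sym_tensGroup_tensMap Y h' p k L
  obtain ⟨s₅, hs₅, e₅⟩ := exists_sym_tensGroup_eqToHom Y _ _ k comm L
  rw [tensHom_comp, tensHom_comp, reassoc_of% e₃, reassoc_of% e₄, e₅, ← reassoc_of% e₁, e₂]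
  -- Both sides have become a `Sym` followed by the same `tensGroup`; the two `Sym`s have equal
  -- lists, hence agree.
  have := ((Sym.tensPerm Y _ _ h₁).comp (hs₁.comp hs₂)).unique
    ((Sym.tensPerm Y _ _ h₃).comp (hs₃.comp (hs₄.comp hs₅)))
  simpa only [Category.assoc] using congrArg (· ≫ tensGroup Y (fun r j => π (h r j)) k L) this

/-- If every group has one element, grouping is reindexing. -/
lemma exists_sym_tensGroup_singleton (Y : ι → V) (h : ∀ r, κ r → ι) (j : ∀ r, κ r) (L : List ρ) :
    ∃ s, Sym Y (L.flatMap fun r => [j r].map (h r)) (L.map fun r => h r (j r)) s ∧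
      tensGroup Y h (fun r => [j r]) L ≫
          tensHom (fun r => tensSingle (fun i => Y (h r i)) (j r) rfl) L =
        s ≫ (tensMap Y (fun r => h r (j r)) L).hom := by
  induction L with
  | nil => exact ⟨_, .id _, by simp [tensGroup, tensHom_nil]; rfl⟩
  | cons r L ih =>
    obtain ⟨s, hs, e⟩ := ih
    refine ⟨_, hs.cons _, ?_⟩
    rw [tensGroup_cons, tensMap_cons Y (fun r => h r (j r)), tensHom_cons, tensSingle_rfl]
    refine Eq.trans ?_ (consHom_comp _ _ _ _).symm
    rw [← e]
    have aux {A B C D : V} (G : B ⟶ C) (f : C ⟶ D) :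
        ((A ◁ (λ_ B).inv ≫ (α_ A (𝟙_ V) B).inv) ≫ ((A ◁ (𝟙 (𝟙_ V) : 𝟙_ V ⟶ 𝟙_ V)) ⊗ₘ G)) ≫ ((ρ_ A).hom ⊗ₘ f) =
          (𝟙 A ≫ 𝟙 A) ⊗ₘ (G ≫ f) := by
      simp [MonoidalCategory.tensorHom_def]
    exact aux _ _

lemma exists_sym_tensMap_eqToHom (Y : ι → V) (g : ι → ι) (hg : ∀ i, g i = i) (L : List ι) :
    ∃ s, Sym Y (L.map g) L s ∧
      (tensMap Y g L).hom ≫ tensHom (fun i => eqToHom (congrArg Y (hg i))) L = s := by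
  obtain rfl : g = fun i => i := funext hg
  induction L with
  | nil => exact ⟨_, .id _, Category.comp_id _⟩
  | cons a L ih =>
    obtain ⟨s, hs, e⟩ := ih
    refine ⟨_, hs.cons a, ?_⟩
    rw [tensMap_cons, tensHom_cons, consHom_comp, e]
    simp

/-- If every group has one element, of index `r` after reindexing along `π`, then reindexing
followed by grouping is the identity. -/
theorem tensPerm_tensMap_tensGroup_singleton {κ : ι' → Type} [DecidableEq ι] [DecidableEq ι']
    (Y : ι' → V) {π : ι → ι'} (hπ : Function.Injective π) {h : ∀ r, κ r → ι} {j : ∀ r, κ r}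
    {k : ∀ r, List (κ r)} (hk : ∀ r, [j r] = k r) (hj : ∀ r, π (h r (j r)) = r)
    {l : List ι} {L : List ι'} (h₁ : L.Perm (l.map π))
    (h₂ : l.Perm (L.flatMap fun r => (k r).map (h r))) :
    (tensPerm Y L (l.map π) h₁).hom ≫ (tensMap Y π l).hom ≫
        (tensPerm (fun i => Y (π i)) l _ h₂).hom ≫ tensGroup (fun i => Y (π i)) h k L ≫
        tensHom (fun r => tensSingle (fun i => Y (π (h r i))) (j r) (hk r) ≫
          eqToHom (congrArg Y (hj r))) L = 𝟙 _ := by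
  obtain rfl : (fun r => [j r]) = k := funext hk
  obtain ⟨s₁, hs₁, e₁⟩ := (Sym.tensPerm (fun i => Y (π i)) l _ h₂).map hπ
  obtain ⟨s₂, hs₂, e₂⟩ := exists_sym_tensMap_tensGroup Y π h (fun r => [j r]) L
  obtain ⟨s₃, hs₃, e₃⟩ := exists_sym_tensGroup_singleton Y (fun r i => π (h r i)) j L
  obtain ⟨s₄, hs₄, e₄⟩ := exists_sym_tensMap_eqToHom Y (fun r => π (h r (j r))) hj L
  -- The whole composite is a `Sym` from `L` to itself, hence the identity.
  have := ((Sym.tensPerm Y _ _ h₁).comp (hs₁.comp (hs₂.comp (hs₃.comp hs₄)))).unique (.id _)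
  rw [← reassoc_of% e₁, reassoc_of% e₂, tensHom_comp, reassoc_of% e₃, e₄]
  exact this

end Group

/-! ### Interleaving two tensor products, and units. -/

section Zip

variable {ι : Type}

lemma tensZip_naturality {X Y X' Y' : ι → V} (f : ∀ i, X i ⟶ X' i) (g : ∀ i, Y i ⟶ Y' i)
    (l : List ι) :
    (tensHom f l ⊗ₘ tensHom g l) ≫ tensZip X' Y' l =
      tensZip X Y l ≫ tensHom (fun i => f i ⊗ₘ g i) l := by
  induction l with
  | nil =>
    have aux : (𝟙 (𝟙_ V) ⊗ₘ 𝟙 (𝟙_ V)) ≫ (λ_ (𝟙_ V)).hom = (λ_ (𝟙_ V)).hom ≫ 𝟙 _ := by simp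
    exact aux
  | cons a l ih =>
    have aux {A A' B B' C C' D D' E E' : V} {a : A ⟶ A'} {b : B ⟶ B'} {c : C ⟶ C'} {d : D ⟶ D'}
        {z : B ⊗ D ⟶ E} {z' : B' ⊗ D' ⟶ E'} {e : E ⟶ E'} (h : (b ⊗ₘ d) ≫ z' = z ≫ e) :
        ((a ⊗ₘ b) ⊗ₘ (c ⊗ₘ d)) ≫ tensorμ A' B' C' D' ≫ (A' ⊗ C') ◁ z' =
          (tensorμ A B C D ≫ (A ⊗ C) ◁ z) ≫ ((a ⊗ₘ c) ⊗ₘ e) := by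
      rw [tensorμ_natural_assoc, Category.assoc, ← id_tensorHom, ← id_tensorHom,
        tensorHom_comp_tensorHom, tensorHom_comp_tensorHom, h, Category.id_comp, Category.comp_id]
    exact aux ih

lemma tensZip_unit_left (Y : ι → V) (l : List ι) :
    (λ_ (tens Y l)).inv ≫ (tensUnit l ▷ tens Y l) ≫ tensZip (fun _ => 𝟙_ V) Y l =
      tensHom (fun i => (λ_ (Y i)).inv) l := by
  induction l with
  | nil =>
    have aux : (λ_ (𝟙_ V)).inv ≫ (𝟙 (𝟙_ V) ▷ 𝟙_ V) ≫ (λ_ (𝟙_ V)).hom = 𝟙 (𝟙_ V) := by simp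
    exact aux
  | cons a l ih =>
    have aux {A B E U : V} {u : 𝟙_ V ⟶ U} {z : U ⊗ B ⟶ E} {e : B ⟶ E}
        (h : (λ_ B).inv ≫ u ▷ B ≫ z = e) :
        (λ_ (A ⊗ B)).inv ≫ ((λ_ (𝟙_ V)).inv ≫ 𝟙_ V ◁ u) ▷ (A ⊗ B) ≫ tensorμ (𝟙_ V) U A B ≫
          (𝟙_ V ⊗ A) ◁ z = (λ_ A).inv ⊗ₘ e := by
      have h₁ := tensor_left_unitality A B
      have h₂ : (λ_ (A ⊗ B)).inv ≫ (λ_ (𝟙_ V)).inv ▷ (A ⊗ B) ≫ tensorμ (𝟙_ V) (𝟙_ V) A B =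
          ((λ_ A).inv ⊗ₘ (λ_ B).inv) := by
        rw [Iso.inv_comp_eq, h₁]
        simp [tensorHom_comp_tensorHom]
      have h₃ := tensorμ_natural_left (𝟙 (𝟙_ V)) u A B
      rw [id_tensorHom] at h₃
      rw [comp_whiskerRight, Category.assoc, reassoc_of% h₃, reassoc_of% h₂, ← id_tensorHom,
        tensorHom_comp_tensorHom, tensorHom_comp_tensorHom, ← h]
      simp
    exact aux ih

lemma tensZip_unit_right (X : ι → V) (l : List ι) :
    (ρ_ (tens X l)).inv ≫ (tens X l ◁ tensUnit l) ≫ tensZip X (fun _ => 𝟙_ V) l =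
      tensHom (fun i => (ρ_ (X i)).inv) l := by
  induction l with
  | nil =>
    have aux : (ρ_ (𝟙_ V)).inv ≫ (𝟙_ V ◁ 𝟙 (𝟙_ V)) ≫ (λ_ (𝟙_ V)).hom = 𝟙 (𝟙_ V) := by
      rw [← unitors_inv_equal]; simp
    exact aux
  | cons a l ih =>
    have aux {A B E U : V} {u : 𝟙_ V ⟶ U} {z : B ⊗ U ⟶ E} {e : B ⟶ E}
        (h : (ρ_ B).inv ≫ B ◁ u ≫ z = e) :
        (ρ_ (A ⊗ B)).inv ≫ (A ⊗ B) ◁ ((λ_ (𝟙_ V)).inv ≫ 𝟙_ V ◁ u) ≫ tensorμ A B (𝟙_ V) U ≫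
          (A ⊗ 𝟙_ V) ◁ z = (ρ_ A).inv ⊗ₘ e := by
      have h₁ := tensor_right_unitality A B
      have h₂ : (ρ_ (A ⊗ B)).inv ≫ (A ⊗ B) ◁ (λ_ (𝟙_ V)).inv ≫ tensorμ A B (𝟙_ V) (𝟙_ V) =
          ((ρ_ A).inv ⊗ₘ (ρ_ B).inv) := by
        rw [Iso.inv_comp_eq, h₁]
        simp [tensorHom_comp_tensorHom]
      have h₃ := tensorμ_natural_right A B (𝟙 (𝟙_ V)) u
      rw [id_tensorHom] at h₃
      rw [MonoidalCategory.whiskerLeft_comp, Category.assoc, reassoc_of% h₃, reassoc_of% h₂,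
        ← id_tensorHom (A ⊗ 𝟙_ V), tensorHom_comp_tensorHom, tensorHom_comp_tensorHom, ← h]
      simp
    exact aux ih

end Zip

end Coherence
-- Fibres, actions of quasibijections, and the two basic identities in an `n`-operad.
section Ordinals

variable {I : Type} [LinearOrder I]

namespace NOrd

lemma hom_ext {T S : NOrd I} {f g : T ⟶ S} (h : ∀ a, fn f a = fn g a) : f = g :=
  Hom.ext (funext h)

lemma hom_fibre_ext {T S R : NOrd I} {σ : T ⟶ S} {s : Fin S.card} {f g : R ⟶ fibre σ s}
    (h : ∀ a, fibreIncl σ s (fn f a) = fibreIncl σ s (fn g a)) : f = g :=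
  hom_ext fun a => (fibreIncl_strictMono σ s).injective (h a)

/-- Objects of the skeleton are rigid: a strictly increasing self-map of a finite chain is the
identity. This makes the casts between equal fibres comparable with induced maps. -/
lemma eq_eqToHom {T S : NOrd I} {κ : T ⟶ S} (hκ : StrictMono (fn κ)) (h : T = S) :
    κ = eqToHom h := by
  subst h
  refine hom_ext fun a => ?_
  have : fn κ = id := (hκ.range_inj strictMono_id).1 <| by
    rw [Set.range_id, (Finite.injective_iff_surjective.1 hκ.injective).range_eq]
  rw [this]
  rfl

lemma strictMono_fibreMap {T' S' T S : NOrd I} {π : T' ⟶ T} {σ' : T' ⟶ S'} {σ : T ⟶ S}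
    {s' : Fin S'.card} {s : Fin S.card} {h : ∀ t, fn σ' t = s' → fn σ (fn π t) = s}
    (hπ : ∀ a b, fn σ' a = s' → fn σ' b = s' → a < b → fn π a < fn π b) :
    StrictMono (fn (fibreMap π σ' σ s' s h)) := fun a b hab => by
  rw [← (fibreIncl_strictMono σ s).lt_iff_lt, fibreIncl_fibreMap, fibreIncl_fibreMap]
  exact hπ _ _ (fn_fibreIncl _ _ _) (fn_fibreIncl _ _ _) (fibreIncl_strictMono _ _ hab)

/-- Composition with a quasibijection does not change the fibres. -/
lemma fibre_comp_quasibijection {T S' S : NOrd I} {f : T ⟶ S} {σ : T ⟶ S'} {ρ : S' ⟶ S}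
    (hρ : quasibijections I ρ) (w : f = σ ≫ ρ) (s : Fin S'.card) :
    fibre f (fn ρ s) = fibre σ s := by
  refine eq_of_embedding (T := T) (fibreIncl f _) (fibreIncl σ s) (fibreIncl_strictMono _ _)
    (fibreIncl_strictMono _ _) (fun _ _ _ => Iff.rfl) (fun _ _ _ => Iff.rfl) ?_
  rw [range_fibreIncl, range_fibreIncl]
  ext t
  change fn f t = fn ρ s ↔ fn σ t = s
  rw [w, fn_comp, hρ.1.eq_iff]

/-- For a composite `f` of `σ : T ⟶ S` and `ω : S ⟶ R`, the `r`-th fibre `σ_r : T_r ⟶ S_r` of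
`σ`. -/
abbrev fibreRestr {T S R : NOrd I} {σ : T ⟶ S} {ω : S ⟶ R} {f : T ⟶ R} (w : f = σ ≫ ω)
    (r : Fin R.card) : fibre f r ⟶ fibre ω r :=
  fibreMap σ f ω r r fun t ht => by rw [← fn_comp, ← w, ht]

lemma fibre_fibreRestr {T S R : NOrd I} {σ : T ⟶ S} {ω : S ⟶ R} {f : T ⟶ R} (w : f = σ ≫ ω)
    (r : Fin R.card) (j : Fin (fibre ω r).card) :
    fibre σ (fibreIncl ω r j) = fibre (fibreRestr w r) j := by
  subst w
  exact fibre_restr σ ω r j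

lemma quasibijections_fibreRestr {T' T S : NOrd I} {π : T' ⟶ T} (hπ : quasibijections I π)
    {σ : T ⟶ S} {f : T' ⟶ S} (w : f = π ≫ σ) (s : Fin S.card) :
    quasibijections I (fibreRestr w s) :=
  quasibijections_fibreMap hπ (MorphismProperty.id_mem _ S) ((Category.comp_id f).trans w) s s rfl _

end NOrd

open NOrd

variable {V : Type u} [Category.{v} V]

/-- A contravariant action of the quasibijections on a family of objects. -/
structure QuasiAction (X : NOrd I → V) where
  map : ∀ {T S : NOrd I} (σ : T ⟶ S), quasibijections I σ → (X S ⟶ X T)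
  map_id : ∀ T : NOrd I, map (𝟙 T) (MorphismProperty.id_mem _ T) = 𝟙 (X T)
  map_comp : ∀ {T S R : NOrd I} (σ : T ⟶ S) (ω : S ⟶ R) (hσ : quasibijections I σ)
    (hω : quasibijections I ω),
    map (σ ≫ ω) (MorphismProperty.comp_mem _ σ ω hσ hω) = map ω hω ≫ map σ hσ

namespace QuasiAction

variable {X : NOrd I → V} (a : QuasiAction X)

lemma map_comp_eq {T S R : NOrd I} {σ : T ⟶ S} {ω : S ⟶ R} {f : T ⟶ R}
    {hσ : quasibijections I σ} {hω : quasibijections I ω} {hf : quasibijections I f}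
    (w : f = σ ≫ ω) : a.map ω hω ≫ a.map σ hσ = a.map f hf := by
  subst w
  exact (a.map_comp σ ω hσ hω).symm

lemma map_eq_eqToHom {T S : NOrd I} {κ : T ⟶ S} (hκ : quasibijections I κ)
    (hm : StrictMono (fn κ)) (h : S = T) : a.map κ hκ = eqToHom (congrArg X h) := by
  obtain rfl := eq_eqToHom hm h.symm
  subst h
  exact a.map_id S

end QuasiAction

variable [MonoidalCategory V]

/-- The units `I ⟶ I ⊗ ⋯ ⊗ I ⟶ A_{T_0} ⊗ ⋯ ⊗ A_{T_k}` in the fibres of a quasibijection. -/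
def fibreUnits {X : NOrd I → V} (e : 𝟙_ V ⟶ X (unit I)) {T S : NOrd I} (σ : T ⟶ S)
    (hσ : quasibijections I σ) : 𝟙_ V ⟶ fibreTens X σ :=
  tensUnit S.elems ≫
    tensHom (fun s => e ≫ eqToHom (congrArg X (fibre_quasibijection hσ s))) S.elems

lemma insertUnits_eq {X : NOrd I → V} (e : 𝟙_ V ⟶ X (unit I)) {T S : NOrd I} (σ : T ⟶ S)
    (hσ : quasibijections I σ) :
    insertUnits e σ hσ = (ρ_ (X S)).inv ≫ (X S ◁ fibreUnits e σ hσ) := rfl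

variable [SymmetricCategory V]

/-- The symmetry `⨂_{s ∈ S} A_{T_s} ⟶ ⨂_{r ∈ R} ⨂_{j ∈ S_r} A_{(T_r)_j}` for a composite `f` of
`σ : T ⟶ S` and `ω : S ⟶ R`. -/
def fibreGroup (X : NOrd I → V) {T S R : NOrd I} {σ : T ⟶ S} {ω : S ⟶ R} {f : T ⟶ R}
    (w : f = σ ≫ ω) : fibreTens X σ ⟶ tens (fun r => fibreTens X (fibreRestr w r)) R.elems :=
  (tensPerm (fun s => X (fibre σ s)) _ _ (perm_fibres ω)).hom ≫
    tensGroup (fun s => X (fibre σ s)) (fibreIncl ω) (fun r => (fibre ω r).elems) R.elems ≫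
    tensHom (fun r => tensHom (fun j => eqToHom (congrArg X (fibre_fibreRestr w r j)))
      (fibre ω r).elems) R.elems

lemma shuffle_eq (X : NOrd I → V) {T S R : NOrd I} (σ : T ⟶ S) (ω : S ⟶ R) :
    shuffle X σ ω = (fibreTens X ω ◁ fibreGroup X (rfl : σ ≫ ω = σ ≫ ω)) ≫
      tensZip (fun r => X (fibre ω r)) (fun r => fibreTens X (fibreRestr (rfl : σ ≫ ω = σ ≫ ω) r))
        R.elems := by
  rw [shuffle, tensHom_comp, fibreGroup, tensGroup, Category.assoc]
  rfl

/-- The symmetry `⨂_{s ∈ S} A_{T_s} ⟶ ⨂_{s' ∈ S'} A_{T_{s'}}` for `σ : T ⟶ S'` and a quasibijection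
`ρ : S' ⟶ S`. -/
def fibreReindex (X : NOrd I → V) {T S' S : NOrd I} {f : T ⟶ S} {σ : T ⟶ S'} {ρ : S' ⟶ S}
    (hρ : quasibijections I ρ) (w : f = σ ≫ ρ) : fibreTens X f ⟶ fibreTens X σ :=
  (tensPerm (fun s => X (fibre f s)) _ _ (perm_bijection hρ)).hom ≫
    (tensMap (fun s => X (fibre f s)) (fn ρ) S'.elems).hom ≫
    tensHom (fun s' => eqToHom (congrArg X (fibre_comp_quasibijection hρ w s'))) S'.elems

instance (X : NOrd I → V) {T S' S : NOrd I} {f : T ⟶ S} {σ : T ⟶ S'} {ρ : S' ⟶ S}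
    (hρ : quasibijections I ρ) (w : f = σ ≫ ρ) : IsIso (fibreReindex X hρ w) := by
  unfold fibreReindex
  infer_instance

/-- Each `σ_r` is again a quasibijection, and units are insensitive to permuting and grouping, so
units in the fibres of `σ` become units in the fibres of every `σ_r`. -/
lemma fibreUnits_fibreGroup {X : NOrd I → V} (e : 𝟙_ V ⟶ X (unit I)) {T S R : NOrd I} {σ : T ⟶ S}
    {ω : S ⟶ R} {f : T ⟶ R} (w : f = σ ≫ ω) (hσ : quasibijections I σ) :
    fibreUnits e σ hσ ≫ fibreGroup X w = tensUnit R.elems ≫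
      tensHom (fun r => fibreUnits e (fibreRestr w r) (quasibijections_fibreRestr hσ w r))
        R.elems := by
  rw [fibreUnits, fibreGroup, Category.assoc, ← reassoc_of% (tensPerm_naturality
    (fun s => e ≫ eqToHom (congrArg X (fibre_quasibijection hσ s)))), reassoc_of% (tensGroup_naturality
    (fun s => e ≫ eqToHom (congrArg X (fibre_quasibijection hσ s)))),
    reassoc_of% (Sym.tensPerm _ _ _ (perm_fibres ω)).tensUnit, reassoc_of% tensUnit_tensGroup,
    ← tensHom_comp, ← tensHom_comp]
  congr 2
  funext r
  rw [← tensHom_comp]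
  simp only [Category.assoc, eqToHom_trans]
  rfl

namespace OperadStr

/-- Associativity with the composite as a variable `f`, so that it applies when the same map arises
from several factorisations, whose fibres would otherwise have different types. -/
lemma assoc_of_eq {W : MorphismProperty (NOrd I)} [IsOperadic W] {X : NOrd I → V}
    (A : OperadStr W X) {T S R : NOrd I} {σ : T ⟶ S} {ω : S ⟶ R} {f : T ⟶ R} (w : f = σ ≫ ω)
    (hσ : W σ) (hω : W ω) (hf : W f) (hr : ∀ r, W (fibreRestr w r)) :
    (A.mul ω hω ▷ fibreTens X σ) ≫ A.mul σ hσ =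
      (α_ (X R) (fibreTens X ω) (fibreTens X σ)).hom ≫
        (X R ◁ ((fibreTens X ω ◁ fibreGroup X w) ≫
          tensZip (fun r => X (fibre ω r)) (fun r => fibreTens X (fibreRestr w r)) R.elems ≫
          tensHom (fun r => A.mul (fibreRestr w r) (hr r)) R.elems)) ≫ A.mul f hf := by
  subst w
  rw [A.assoc σ ω hσ hω, shuffle_eq]
  exact congrArg (fun g => (α_ (X R) (fibreTens X ω) (fibreTens X σ)).hom ≫ (X R ◁ g) ≫
    A.mul (σ ≫ ω) hf) (Category.assoc _ _ _)

variable {X : NOrd I → V} (A : OperadStr ⊤ X)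

/-- Associativity for `π` followed by `σ`, with units inserted in the fibres of `π`: on the outside
they turn `m_π` into `A(π)`, and after interleaving they turn each `m_{π_s}` into `A(π_s)`. -/
lemma mul_comp_act {T' T S : NOrd I} {π : T' ⟶ T} (hπ : quasibijections I π) {σ : T ⟶ S}
    {f : T' ⟶ S} (w : f = π ≫ σ) :
    A.mul σ trivial ≫ A.act π hπ = (X S ◁ tensHom (fun s =>
      A.act (fibreRestr w s) (quasibijections_fibreRestr hπ w s)) S.elems) ≫ A.mul f trivial := by
  have key := congrArg (fun g => (ρ_ (X S ⊗ fibreTens X σ)).inv ≫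
    ((X S ⊗ fibreTens X σ) ◁ fibreUnits A.e π hπ) ≫ g)
    (A.assoc_of_eq w trivial trivial trivial fun _ => trivial)
  have h₁ : A.mul σ trivial ≫ A.act π hπ = (ρ_ (X S ⊗ fibreTens X σ)).inv ≫
      ((X S ⊗ fibreTens X σ) ◁ fibreUnits A.e π hπ) ≫ (A.mul σ trivial ▷ fibreTens X π) ≫
        A.mul π trivial := by
    rw [act, insertUnits_eq, whisker_exchange_assoc]
    simp
  have h₂ : tensHom (fun s => A.act (fibreRestr w s) (quasibijections_fibreRestr hπ w s)) S.elems =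
      (ρ_ (fibreTens X σ)).inv ≫ (fibreTens X σ ◁ fibreUnits A.e π hπ) ≫
        (fibreTens X σ ◁ fibreGroup X w) ≫
        tensZip (fun s => X (fibre σ s)) (fun s => fibreTens X (fibreRestr w s)) S.elems ≫
        tensHom (fun s => A.mul (fibreRestr w s) trivial) S.elems := by
    have h₃ := tensZip_naturality (fun s => 𝟙 (X (fibre σ s)))
      (fun s => fibreUnits A.e (fibreRestr w s) (quasibijections_fibreRestr hπ w s)) S.elems
    rw [tensHom_id, id_tensorHom] at h₃
    rw [← whiskerLeft_comp_assoc, fibreUnits_fibreGroup, whiskerLeft_comp_assoc, reassoc_of% h₃,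
      reassoc_of% (tensZip_unit_right (fun s => X (fibre σ s)) S.elems), ← tensHom_comp,
      ← tensHom_comp]
    congr 1
    funext s
    rw [act, insertUnits_eq, id_tensorHom, Category.assoc]
  rw [h₁, key, h₂]
  simp

lemma act_id (T : NOrd I) : A.act (𝟙 T) (MorphismProperty.id_mem _ T) = 𝟙 (X T) := A.mul_id T

/-- The only endomorphism of the terminal object is the identity, and identities act trivially by
the unit law. -/
lemma act_eq_eqToHom_of_unit {T S : NOrd I} (κ : T ⟶ S) (hκ : quasibijections I κ)
    (hT : unit I = T) (hS : unit I = S) :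
    A.act κ hκ = eqToHom (congrArg X (hS.symm.trans hT)) := by
  subst hT hS
  obtain rfl : κ = 𝟙 _ := (toUnit_unique κ).trans (toUnit_unique _).symm
  exact A.act_id _

lemma fibreUnits_act {T S R : NOrd I} {σ : T ⟶ S} {ω : S ⟶ R} {f : T ⟶ R} (w : f = σ ≫ ω)
    (hσ : quasibijections I σ) (hω : quasibijections I ω) (hf : quasibijections I f) :
    fibreUnits A.e ω hω ≫ tensHom (fun r => A.act (fibreRestr w r)
      (quasibijections_fibreRestr hσ w r)) R.elems = fibreUnits A.e f hf := by
  rw [fibreUnits, fibreUnits, Category.assoc, ← tensHom_comp]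
  congr 2
  funext r
  rw [A.act_eq_eqToHom_of_unit _ _ (fibre_quasibijection hf r) (fibre_quasibijection hω r),
    Category.assoc, eqToHom_trans]

lemma act_comp {T S R : NOrd I} (σ : T ⟶ S) (ω : S ⟶ R) (hσ : quasibijections I σ)
    (hω : quasibijections I ω) :
    A.act (σ ≫ ω) (MorphismProperty.comp_mem _ σ ω hσ hω) = A.act ω hω ≫ A.act σ hσ := by
  rw [act.eq_1 A ω, Category.assoc, A.mul_comp_act hσ rfl, act, insertUnits_eq, insertUnits_eq,
    ← A.fibreUnits_act rfl hσ hω, MonoidalCategory.whiskerLeft_comp]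
  simp only [Category.assoc]

/-- The action of the quasibijections on an `n`-operad. -/
@[simps]
def quasiAction : QuasiAction X where
  map := A.act
  map_id := A.act_id
  map_comp := A.act_comp

/-- The unit law for `T ⟶ U_n` when the target is only propositionally `U_n`, as happens for the
fibres of a quasibijection. -/
lemma unit_comp_mul {T S : NOrd I} (κ : T ⟶ S) (hS : unit I = S) (s : Fin S.card)
    (hs : [s] = S.elems) (hT : fibre κ s = T) :
    (λ_ (fibreTens X κ)).inv ≫ ((A.e ≫ eqToHom (congrArg X hS)) ⊗ₘ 𝟙 _) ≫ A.mul κ trivial =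
      tensSingle (fun s => X (fibre κ s)) s hs ≫ eqToHom (congrArg X hT) := by
  subst hS
  obtain rfl := toUnit_unique κ
  obtain rfl : s = (0 : Fin 1) := Subsingleton.elim (α := Fin 1) _ _
  have key := A.mul_toUnit T
  have aux {P Q E : V} (e : 𝟙_ V ⟶ E) (i : P ≅ Q) (m : E ⊗ (Q ⊗ 𝟙_ V) ⟶ P)
      (h : (λ_ P).inv ≫ (e ⊗ₘ ((ρ_ P).inv ≫ i.hom ▷ 𝟙_ V)) ≫ m = 𝟙 P) :
      (λ_ (Q ⊗ 𝟙_ V)).inv ≫ (e ⊗ₘ 𝟙 (Q ⊗ 𝟙_ V)) ≫ m = (ρ_ Q).hom ≫ i.inv := by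
    rw [← cancel_epi ((ρ_ P).inv ≫ i.hom ▷ 𝟙_ V)]
    have h' : ((ρ_ P).inv ≫ i.hom ▷ 𝟙_ V) ≫ (ρ_ Q).hom ≫ i.inv = 𝟙 P := by simp
    rw [h']
    rw [leftUnitor_inv_naturality_assoc, ← id_tensorHom, tensorHom_comp_tensorHom_assoc,
      Category.id_comp, Category.comp_id, h]
  rw [eqToHom_refl, Category.comp_id]
  refine (aux A.e (eqToIso (congrArg X (fibre_toUnit T (0 : Fin 1)))) (A.mul (toUnit T) trivial)
    key).trans ?_
  exact congrArg (· ≫ eqToHom (congrArg X hT)) (tensSingle_rfl (fun s => X (fibre _ s)) _).symm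

/-- Associativity for `σ` followed by `ρ`, with units inserted in the fibres of `ρ`. Each induced
map `T_s ⟶ S'_s` has target `U_n`, so the unit law removes its multiplication, and what remains is
the permutation of the fibres. -/
lemma act_tensorHom_comp_mul {T S' S : NOrd I} {ρ : S' ⟶ S} (hρ : quasibijections I ρ)
    {σ : T ⟶ S'} {f : T ⟶ S} (w : f = σ ≫ ρ) :
    (A.act ρ hρ ⊗ₘ fibreReindex X hρ w) ≫ A.mul σ trivial = A.mul f trivial := by
  have h₁ : (A.act ρ hρ ⊗ₘ fibreReindex X hρ w) ≫ A.mul σ trivial =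
      (X S ◁ fibreReindex X hρ w) ≫ ((ρ_ (X S)).inv ▷ fibreTens X σ) ≫
        ((X S ◁ fibreUnits A.e ρ hρ) ▷ fibreTens X σ) ≫ (A.mul ρ trivial ▷ fibreTens X σ) ≫
        A.mul σ trivial := by
    rw [act, insertUnits_eq, MonoidalCategory.tensorHom_def']
    simp
  have h₂ {P U F G W : V} (u : 𝟙_ V ⟶ U) (g : U ⊗ F ⟶ G) (m : P ⊗ G ⟶ W) :
      (ρ_ P).inv ▷ F ≫ (P ◁ u) ▷ F ≫ (α_ P U F).hom ≫ P ◁ g ≫ m =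
        P ◁ ((λ_ F).inv ≫ u ▷ F ≫ g) ≫ m := by simp
  have hc (s : Fin S.card) : ∃ j : Fin (fibre ρ s).card, [j] = (fibre ρ s).elems := by
    rw [← fibre_quasibijection hρ s]
    exact ⟨(0 : Fin 1), rfl⟩
  choose j hj using hc
  have hT (s : Fin S.card) : fibre (fibreRestr w s) (j s) = fibre f s := by
    have := fibre_comp_quasibijection hρ w (fibreIncl ρ s (j s))
    rw [← fibre_fibreRestr w, ← this, fn_fibreIncl]
  have h₃ := tensZip_naturality
    (fun s => A.e ≫ eqToHom (congrArg X (fibre_quasibijection hρ s)))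
    (fun s => 𝟙 (fibreTens X (fibreRestr w s))) S.elems
  rw [tensHom_id, tensorHom_id] at h₃
  have h₄ : (λ_ (fibreTens X σ)).inv ≫ fibreUnits A.e ρ hρ ▷ fibreTens X σ ≫
      (fibreTens X ρ ◁ fibreGroup X w) ≫
      tensZip (fun s => X (fibre ρ s)) (fun s => fibreTens X (fibreRestr w s)) S.elems ≫
      tensHom (fun r => A.mul (fibreRestr w r) trivial) S.elems =
      fibreGroup X w ≫ tensHom (fun s =>
        tensSingle (fun i => X (fibre (fibreRestr w s) i)) (j s) (hj s) ≫
          eqToHom (congrArg X (hT s))) S.elems := by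
    rw [← whisker_exchange_assoc, ← leftUnitor_inv_naturality_assoc,
      fibreUnits, comp_whiskerRight_assoc, reassoc_of% h₃, reassoc_of% (tensZip_unit_left
      (fun s => fibreTens X (fibreRestr w s)) S.elems), ← tensHom_comp, ← tensHom_comp]
    congr 2
    funext s
    exact A.unit_comp_mul (fibreRestr w s) (fibre_quasibijection hρ s) (j s) (hj s) (hT s)
  -- Grouping by the fibres of a bijection produces one-element groups, and thus undoes the
  -- reindexing.
  have h₅ : fibreReindex X hρ w ≫ fibreGroup X w ≫ tensHom (fun s =>
        tensSingle (fun i => X (fibre (fibreRestr w s) i)) (j s) (hj s) ≫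
          eqToHom (congrArg X (hT s))) S.elems =
        𝟙 (fibreTens X f) := by
    have key := tensPerm_tensMap_tensGroup_singleton (fun s => X (fibre f s)) hρ.1
      (h := fibreIncl ρ) hj (fun s => fn_fibreIncl ρ s (j s)) (perm_bijection hρ) (perm_fibres ρ)
    rw [← key, fibreReindex, fibreGroup]
    simp only [Category.assoc]
    rw [← reassoc_of% (tensPerm_naturality (fun s' => eqToHom (congrArg X
      (fibre_comp_quasibijection hρ w s')))), reassoc_of% (tensGroup_naturality
      (fun s' => eqToHom (congrArg X (fibre_comp_quasibijection hρ w s')))),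
      ← tensHom_comp, ← tensHom_comp]
    congr 5
    funext s
    rw [← reassoc_of% (tensHom_comp (V := V)), reassoc_of% tensSingle_naturality]
    simp only [eqToHom_trans]
  rw [h₁, A.assoc_of_eq w trivial trivial trivial fun _ => trivial, h₂, h₄, ← whiskerLeft_comp_assoc, h₅,
    MonoidalCategory.whiskerLeft_id, Category.id_comp]

end OperadStr

end Ordinals
-- From quasisymmetric `n`-operads to `Q_n`-operads.
section Ordinals

open NOrd

variable {I : Type} [LinearOrder I] {V : Type u} [Category.{v} V]

namespace QuasiAction

variable {X : NOrd I → V} (a : QuasiAction X)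

lemma map_fibreMap_comp_eqToHom {T' S' T S : NOrd I} {σ' : T' ⟶ S'} {σ : T ⟶ S} {π : T' ⟶ T}
    {ρ : S' ⟶ S} (hπ : quasibijections I π) (hρ : quasibijections I ρ) {f : T' ⟶ S}
    (w : f = π ≫ σ) (w' : f = σ' ≫ ρ) (s' : Fin S'.card) :
    a.map (fibreRestr w (fn ρ s')) (quasibijections_fibreRestr hπ w _) ≫
      eqToHom (congrArg X (fibre_comp_quasibijection hρ w' s')) =
      a.map (fibreMap π σ' σ s' (fn ρ s') fun t ht => by rw [← fn_comp, ← w, w', fn_comp, ht])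
        (quasibijections_fibreMap hπ hρ (w'.symm.trans w) s' _ rfl _) := by
  rw [← a.map_eq_eqToHom (h := fibre_comp_quasibijection hρ w' s') (κ := fibreMap (𝟙 T') σ' f s' (fn ρ s')
    fun t ht => by rw [w', fn_comp, fn_id, ht]) (quasibijections_fibreMap
      (MorphismProperty.id_mem _ _) hρ (w'.symm.trans (Category.id_comp _).symm) s' _ rfl _)
    (strictMono_fibreMap fun _ _ _ _ h => h)]
  exact a.map_comp_eq (hom_fibre_ext fun _ => by simp)

variable [MonoidalCategory V] [SymmetricCategory V]

/-- Splits the symmetry in the first equivariance law into the action of `π` on the fibres over `S`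
and a pure reindexing along `ρ`. These are the ingredients of the two basic identities. -/
lemma tensHom_comp_fibreReindex {T' S' T S : NOrd I} {σ' : T' ⟶ S'} {σ : T ⟶ S} {π : T' ⟶ T}
    {ρ : S' ⟶ S} (hπ : quasibijections I π) (hρ : quasibijections I ρ) {f : T' ⟶ S}
    (w : f = π ≫ σ) (w' : f = σ' ≫ ρ) :
    tensHom (fun s => a.map (fibreRestr w s) (quasibijections_fibreRestr hπ w s)) S.elems ≫
        fibreReindex X hρ w' =
      (tensPerm (fun s => X (fibre σ s)) _ _ (perm_bijection hρ)).hom ≫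
        (tensMap (fun s => X (fibre σ s)) (fn ρ) S'.elems).hom ≫
        tensHom (fun s' => a.map
          (fibreMap π σ' σ s' (fn ρ s') fun t ht => by rw [← fn_comp, ← w, w', fn_comp, ht])
          (quasibijections_fibreMap hπ hρ (w'.symm.trans w) s' _ rfl _)) S'.elems := by
  rw [fibreReindex, ← reassoc_of% (tensPerm_naturality (V := V)),
    reassoc_of% (tensMap_naturality (V := V)), ← tensHom_comp]
  simp only [a.map_fibreMap_comp_eqToHom hπ hρ w w']

end QuasiAction

namespace PiQCollection

/-- The action of the quasibijections on a functor on their fundamental groupoid. -/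
@[simps]
def quasiAction (F : PiQCollection I V) : QuasiAction F.val where
  map := F.act
  map_id T := by
    have := (FreeGroupoid.of (QCat I)).map_id ⟨T⟩
    exact (congrArg (fun f => F.map f.op) this).trans (F.map_id _)
  map_comp {T S R} σ ω hσ hω := by
    have := (FreeGroupoid.of (QCat I)).map_comp (X := ⟨T⟩) (Y := ⟨S⟩) (Z := ⟨R⟩)
      (InducedWideCategory.Hom.mk σ hσ) (InducedWideCategory.Hom.mk ω hω)
    exact (congrArg (fun f => F.map f.op) this).trans (F.map_comp _ _)

instance (F : PiQCollection I V) {T S : NOrd I} (σ : T ⟶ S) (hσ : quasibijections I σ) :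
    IsIso (F.quasiAction.map σ hσ) := inferInstanceAs (IsIso (F.act σ hσ))

end PiQCollection

namespace QuasiAction

variable {X : NOrd I → V} (a : QuasiAction X)

/-- The functor on the fundamental groupoid given by an action of the quasibijections by
isomorphisms. -/
def collection (ha : ∀ {T S : NOrd I} (σ : T ⟶ S) (hσ : quasibijections I σ), IsIso (a.map σ hσ)) :
    PiQCollection I V :=
  let φ : QCat I ⥤ Core V :=
    { obj := fun T => ⟨X T.obj⟩
      -- The action is contravariant while the functor to the groupoid `Core V` is covariant, hence
      -- the inverse; taking `iso.inv` after lifting undoes it.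
      map := fun σ => ⟨(@asIso _ _ _ _ (a.map σ.hom σ.property) (ha _ _)).symm⟩
      map_id := fun T => Core.hom_ext (by
        have := ha (𝟙 T.obj) (MorphismProperty.id_mem _ _)
        exact (IsIso.inv_eq_inv.2 (a.map_id T.obj)).trans IsIso.inv_id)
      map_comp := fun {T S R} σ ω => Core.hom_ext (by
        have := ha σ.hom σ.property
        have := ha ω.hom ω.property
        have := ha _ (MorphismProperty.comp_mem _ _ _ σ.property ω.property)
        exact (IsIso.inv_eq_inv.2 (a.map_comp _ _ σ.property ω.property)).trans IsIso.inv_comp) }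
  { obj := fun P => ((FreeGroupoid.lift φ).obj P.unop).of
    map := fun f => ((FreeGroupoid.lift φ).map f.unop).iso.inv
    map_id := fun P => by
      rw [unop_id, CategoryTheory.Functor.map_id]
      rfl
    map_comp := fun f g => by
      rw [unop_comp, CategoryTheory.Functor.map_comp]
      rfl }

lemma collection_act
    (ha : ∀ {T S : NOrd I} (σ : T ⟶ S) (hσ : quasibijections I σ), IsIso (a.map σ hσ))
    {T S : NOrd I} (σ : T ⟶ S) (hσ : quasibijections I σ) :
    (a.collection ha).act σ hσ = a.map σ hσ := by
  unfold PiQCollection.act collection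
  dsimp only [Quiver.Hom.unop_op]
  rw [FreeGroupoid.lift_map_homMk]
  rfl

end QuasiAction

namespace PiQCollection

/-- A family of morphisms that commutes with the quasibijections is a natural transformation. -/
def homMk {F G : PiQCollection I V} (α : ∀ T, F.val T ⟶ G.val T)
    (hα : ∀ {T S : NOrd I} (σ : T ⟶ S) (hσ : quasibijections I σ),
      F.act σ hσ ≫ α T = α S ≫ G.act σ hσ) : F ⟶ G where
  app P := α P.unop.as.as.obj
  naturality P Q f := by
    -- Naturality on formal inverses comes from the universal property of the localisation. It
    -- concerns covariant functors, so it is applied to functors into the opposite of `V`, where the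
    -- transformation runs from `G` to `F`.
    let τ : FreeGroupoid.of (QCat I) ⋙ G.rightOp ⟶ FreeGroupoid.of (QCat I) ⋙ F.rightOp :=
      { app := fun T => (α T.obj).op
        naturality := fun _ _ σ => Quiver.Hom.unop_inj (hα σ.hom σ.property).symm }
    let τ' : G.rightOp ⟶ F.rightOp := Localization.liftNatTrans (FreeGroupoid.of (QCat I)) ⊤
      (FreeGroupoid.of (QCat I) ⋙ G.rightOp) (FreeGroupoid.of (QCat I) ⋙ F.rightOp) _ _ τ
    have hτ (P : PiQ I) : τ'.app P = (α P.as.as.obj).op := by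
      have := Localization.liftNatTrans_app (FreeGroupoid.of (QCat I)) ⊤
        (FreeGroupoid.of (QCat I) ⋙ G.rightOp) (FreeGroupoid.of (QCat I) ⋙ F.rightOp)
        G.rightOp F.rightOp τ P.as.as
      refine this.trans ?_
      exact (Category.id_comp _).trans (Category.comp_id _)
    have h := congrArg Quiver.Hom.unop (τ'.naturality f.unop)
    rw [hτ, hτ] at h
    exact h.symm

end PiQCollection

section Restriction

variable [MonoidalCategory V] [SymmetricCategory V]

/-- The `Q_n`-operad given by a quasisymmetric `n`-operad structure. -/
def QOperad.ofOperadStr (F : PiQCollection I V) (A : OperadStr ⊤ F.val)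
    (hF : ∀ {T S : NOrd I} (σ : T ⟶ S) (hσ : quasibijections I σ), F.act σ hσ = A.act σ hσ) :
    QOperad I V where
  F := F
  str := A.restrict
  equivariance₁ σ' σ π ρ hσ' hσ hπ hρ w := by
    change A.mul σ trivial ≫ _ = _ ≫ A.mul σ' trivial
    simp only [hF]
    have key := A.quasiAction.tensHom_comp_fibreReindex hπ hρ rfl w.symm
    simp only [OperadStr.quasiAction_map] at key
    -- Both sides are compared with the multiplication for the diagonal of the square.
    rw [A.mul_comp_act hπ rfl, ← A.act_tensorHom_comp_mul hρ w.symm, ← key, ← id_tensorHom,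
      tensorHom_comp_tensorHom_assoc, Category.id_comp]
  equivariance₂ σ η σ' η' f hσ hη hσ' hη' w w' := by
    change A.mul η' trivial ≫ _ = _ ≫ A.mul η trivial ≫ _
    simp only [hF]
    rw [A.mul_comp_act hσ' w', A.mul_comp_act hσ w, ← whiskerLeft_comp_assoc, ← tensHom_comp]
    simp

/-- The action is built from the unit and the multiplications only, so operad morphisms respect it.
-/
lemma OperadStr.IsHom.act_comp {X Y : NOrd I → V} {A : OperadStr ⊤ X} {B : OperadStr ⊤ Y}
    {f : ∀ T, X T ⟶ Y T} (hf : A.IsHom B f) {T S : NOrd I} (σ : T ⟶ S)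
    (hσ : quasibijections I σ) : A.act σ hσ ≫ f T = f S ≫ B.act σ hσ := by
  have h : fibreUnits A.e σ hσ ≫ tensHom (fun s => f (fibre σ s)) S.elems =
      fibreUnits B.e σ hσ := by
    rw [fibreUnits, fibreUnits, Category.assoc, ← tensHom_comp]
    congr 2
    funext s
    rw [← hf.e_comp]
    have aux {T : NOrd I} (h : unit I = T) :
        (A.e ≫ eqToHom (congrArg X h)) ≫ f T = (A.e ≫ f (unit I)) ≫ eqToHom (congrArg Y h) := by
      subst h
      simp
    exact aux (fibre_quasibijection hσ s)
  rw [OperadStr.act, OperadStr.act, Category.assoc, hf.mul_comp, insertUnits_eq, insertUnits_eq,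
    ← h, MonoidalCategory.tensorHom_def]
  simp [whisker_exchange_assoc]

variable (I V) in
/-- The functor from quasisymmetric `n`-operads to `Q_n`-operads that forgets the multiplications
for the maps that are not order preserving. -/
def restriction : QuasisymmetricOperad I V ⥤ QOperad I V where
  obj A := QOperad.ofOperadStr (A.obj.str.quasiAction.collection A.property) A.obj.str
    (A.obj.str.quasiAction.collection_act A.property)
  map {A B} f :=
    { app := PiQCollection.homMk f.hom.app fun σ hσ => by
        have hA := A.obj.str.quasiAction.collection_act A.property σ hσ
        have hB := B.obj.str.quasiAction.collection_act B.property σ hσ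
        exact (congrArg (· ≫ _) hA).trans ((f.hom.isHom.act_comp σ hσ).trans
          (congrArg (_ ≫ ·) hB.symm))
      isHom := ⟨f.hom.isHom.e_comp, fun σ _ => f.hom.isHom.mul_comp σ trivial⟩ }
  map_id _ := rfl
  map_comp _ _ := rfl

end Restriction

end Ordinals
-- Factorisation of maps of `n`-ordinals.
section Ordinals

open NOrd

variable {I : Type} [LinearOrder I]

section Factorisation

variable [OrderTop I]

namespace NOrd

/-- The relabelling of `T` along a bijection `b`, where the elements are ordered lexicographically
by their images under `σ : T ⟶ S` and their order in `T`. -/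
def lexOrd {T S : NOrd I} (σ : T ⟶ S) (b : Equiv.Perm (Fin T.card))
    (hb : StrictMono fun i => toLex (fn σ (b i), b i)) : NOrd I where
  card := T.card
  str :=
    -- Position `i` holds the element `b i`. Elements of one fibre are related at level `⊤`: every
    -- level `p` satisfies `p ≤ ⊤`, so relations of `T` inside a fibre may be raised there.
    { rel := fun p i j => S.rel p (fn σ (b i)) (fn σ (b j)) ∨
        (fn σ (b i) = fn σ (b j) ∧ b i < b j ∧ p = ⊤)
      irrefl := fun p i h => h.elim (S.str.irrefl p _) fun h => lt_irrefl _ h.2.1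
      existsUnique := fun i j hij => by
        rcases eq_or_ne (fn σ (b i)) (fn σ (b j)) with h | h
        · refine ⟨⊤, ?_, ?_⟩
          · exact (lt_or_gt_of_ne (b.injective.ne hij)).imp (fun h' => Or.inr ⟨h, h', rfl⟩)
              fun h' => Or.inr ⟨h.symm, h', rfl⟩
          · rintro p ((h' | h') | (h' | h'))
            · exact absurd (h ▸ h') (S.str.irrefl p _)
            · exact h'.2.2
            · exact absurd (h ▸ h') (S.str.irrefl p _)
            · exact h'.2.2
        · obtain ⟨p, hp, hp'⟩ := S.str.existsUnique _ _ h
          refine ⟨p, hp.imp Or.inl Or.inl, fun q hq => hp' q ?_⟩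
          exact hq.imp (fun h' => h'.resolve_right fun h' => h h'.1)
            fun h' => h'.resolve_right fun h' => h h'.1.symm
      trans := by
        rintro p q i j k (h | ⟨h, h', rfl⟩) (g | ⟨g, g', rfl⟩)
        · exact Or.inl (S.str.trans _ _ _ _ _ h g)
        · exact Or.inl (by rwa [← g, min_eq_left le_top])
        · exact Or.inl (by rwa [h, min_eq_right le_top])
        · exact Or.inr ⟨h.trans g, h'.trans g', min_self _⟩ }
  total i j := by
    rw [← hb.lt_iff_lt, Prod.Lex.toLex_lt_toLex, exists_or, S.total]
    simp

/-- Every map of `n`-ordinals factors as a quasibijection, which preserves the total order on the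
fibres, followed by an order preserving map. -/
theorem exists_isFactorisation {T S : NOrd I} (σ : T ⟶ S) :
    ∃ (T' : NOrd I) (π : T ⟶ T') (ν : T' ⟶ S), IsFactorisation σ π ν := by
  let k : Fin T.card → Fin S.card ×ₗ Fin T.card := fun a => toLex (fn σ a, a)
  have hk : Function.Injective k := fun a c h => (Prod.ext_iff.1 (toLex.injective h)).2
  -- Sorting by the image first makes the second factor monotone; breaking ties by the order of `T`
  -- makes the first factor increasing on fibres.
  let b : Equiv.Perm (Fin T.card) := Tuple.sort k
  have hb : StrictMono (k ∘ b) :=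
    (Tuple.monotone_sort k).strictMono_of_injective (hk.comp b.injective)
  let π : Hom T (lexOrd σ b hb) := ⟨b.symm, fun p i j hij => by
    change (∃ r, p ≤ r ∧ (S.rel r (fn σ (b (b.symm i))) (fn σ (b (b.symm j))) ∨ _)) ∨ _ ∨
      (∃ r, p < r ∧ (S.rel r (fn σ (b (b.symm j))) (fn σ (b (b.symm i))) ∨ _))
    simp only [Equiv.apply_symm_apply]
    rcases σ.map_rel p i j hij with ⟨r, hr, h⟩ | h | ⟨r, hr, h⟩
    · exact Or.inl ⟨r, hr, Or.inl h⟩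
    · exact Or.inl ⟨⊤, le_top, Or.inr ⟨h, (T.total i j).2 ⟨p, hij⟩, rfl⟩⟩
    · exact Or.inr (Or.inr ⟨r, hr, Or.inl h⟩)⟩
  let ν : Hom (lexOrd σ b hb) S := ⟨fun i => fn σ (b i), fun p i j hij =>
    hij.imp (fun h => ⟨p, le_rfl, h⟩) fun h => Or.inl h.1⟩
  refine ⟨lexOrd σ b hb, π, ν, b.symm.bijective, fun i j hij => ?_, ?_, fun a c h hac => ?_⟩
  · exact Prod.Lex.monotone_fst _ _ (hb.monotone hij)
  · exact hom_ext fun a => congrArg (fn σ) (b.apply_symm_apply a)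
  · change b.symm a < b.symm c
    rw [← hb.lt_iff_lt]
    simpa [k, Prod.Lex.toLex_lt_toLex] using Or.inr ⟨h, hac⟩

end NOrd
end Factorisation
end Ordinals
-- Compatibility of fibrewise actions with grouping and reindexing.
section Ordinals

open NOrd

variable {I : Type} [LinearOrder I] {V : Type u} [Category.{v} V]

namespace NOrd

/-- A cast between equal fibres is computed through embeddings into `T`: two strictly increasing
embeddings with the same range coincide. -/
lemma fibreIncl_eqToHom {T S P : NOrd I} {σ : T ⟶ S} {s : Fin S.card} (h : P = fibre σ s)
    {i : Fin P.card → Fin T.card} (hi : StrictMono i) (hr : Set.range i = {t | fn σ t = s})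
    (a : Fin P.card) : fibreIncl σ s (fn (eqToHom h) a) = i a := by
  subst h
  exact congrFun (((fibreIncl_strictMono σ s).range_inj hi).1
    ((range_fibreIncl σ s).trans hr.symm)) a

lemma fibreIncl_eqToHom_fibreRestr {T S R : NOrd I} {σ : T ⟶ S} {ω : S ⟶ R} {f : T ⟶ R}
    (w : f = σ ≫ ω) (r : Fin R.card) (j : Fin (fibre ω r).card)
    (a : Fin (fibre (fibreRestr w r) j).card) :
    fibreIncl σ _ (fn (eqToHom (fibre_fibreRestr w r j).symm) a) =
      fibreIncl f r (fibreIncl (fibreRestr w r) j a) := by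
  refine fibreIncl_eqToHom (fibre_fibreRestr w r j).symm
    (i := fun a => fibreIncl f r (fibreIncl (fibreRestr w r) j a))
    ((fibreIncl_strictMono _ _).comp (fibreIncl_strictMono _ _)) ?_ a
  rw [Set.range_comp' (fibreIncl f r), range_fibreIncl]
  ext t
  constructor
  · rintro ⟨a, ha, rfl⟩
    have ha' : fn (fibreRestr w r) a = j := ha
    change fn σ _ = _
    rw [← ha', fibreIncl_fibreMap]
  · intro ht
    have ht' : fn σ t = fibreIncl ω r j := ht
    obtain ⟨a, rfl⟩ : t ∈ Set.range (fibreIncl f r) := by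
      rw [range_fibreIncl]
      change fn f t = r
      rw [w, fn_comp, ht', fn_fibreIncl]
    refine ⟨a, (fibreIncl_strictMono ω r).injective ?_, rfl⟩
    rw [fibreIncl_fibreMap, ht']

lemma fibreRestr_comp {T T' S R : NOrd I} {π : T ⟶ T'} {σ : T' ⟶ S} {f : T ⟶ S} {ω : S ⟶ R}
    {g : T' ⟶ R} {k : T ⟶ R} (w₁ : f = π ≫ σ) (w₂ : g = σ ≫ ω) (w₃ : k = f ≫ ω) (w₄ : k = π ≫ g)
    (r : Fin R.card) : fibreRestr w₃ r = fibreRestr w₄ r ≫ fibreRestr w₂ r :=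
  hom_fibre_ext fun a => by simp [w₁]

end NOrd

namespace QuasiAction

variable {X : NOrd I → V} (a : QuasiAction X)

lemma map_comp_eqToHom {P P' Q Q' : NOrd I} {κ : P ⟶ Q} {κ' : P' ⟶ Q'} (hP : P' = P)
    (hQ : Q' = Q) (h : eqToHom hP ≫ κ = κ' ≫ eqToHom hQ) (hκ : quasibijections I κ)
    (hκ' : quasibijections I κ') :
    a.map κ hκ ≫ eqToHom (congrArg X hP.symm) =
      eqToHom (congrArg X hQ.symm) ≫ a.map κ' hκ' := by
  subst hP hQ
  obtain rfl : κ = κ' := by simpa using h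
  simp

variable [MonoidalCategory V]

/-- The action of the restrictions of a quasibijection `π` to the fibres of `f = π ≫ σ`. -/
def fibreMap {T T' S : NOrd I} {π : T ⟶ T'} (hπ : quasibijections I π) {σ : T' ⟶ S} {f : T ⟶ S}
    (w : f = π ≫ σ) : fibreTens X σ ⟶ fibreTens X f :=
  tensHom (fun s => a.map (fibreRestr w s) (quasibijections_fibreRestr hπ w s)) S.elems

lemma fibreMap_comp {T T' T'' S : NOrd I} {π : T ⟶ T'} (hπ : quasibijections I π) {π' : T' ⟶ T''}
    (hπ' : quasibijections I π') {σ : T'' ⟶ S} {g : T' ⟶ S} {f : T ⟶ S} (w : f = π ≫ g)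
    (w' : g = π' ≫ σ) (w'' : f = (π ≫ π') ≫ σ) :
    a.fibreMap hπ' w' ≫ a.fibreMap hπ w =
      a.fibreMap (MorphismProperty.comp_mem _ _ _ hπ hπ') w'' := by
  rw [fibreMap, fibreMap, fibreMap, ← tensHom_comp]
  congr 1
  funext s
  exact a.map_comp_eq (hom_fibre_ext fun _ => by simp)

lemma fibreMap_id {T S : NOrd I} {σ : T ⟶ S} (w : σ = 𝟙 T ≫ σ) :
    a.fibreMap (MorphismProperty.id_mem _ T) w = 𝟙 (fibreTens X σ) := by
  rw [← tensHom_id, fibreMap]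
  congr 1
  funext s
  rw [← a.map_id]
  congr 1
  exact hom_fibre_ext fun _ => by simp

lemma fibreUnits_fibreMap (e : 𝟙_ V ⟶ X (unit I)) {T S R : NOrd I} {σ : T ⟶ S} {ω : S ⟶ R}
    {f : T ⟶ R} (w : f = σ ≫ ω) (hσ : quasibijections I σ) (hω : quasibijections I ω)
    (hf : quasibijections I f) :
    fibreUnits e ω hω ≫ a.fibreMap hσ w = fibreUnits e f hf := by
  rw [fibreUnits, fibreUnits, fibreMap, Category.assoc, ← tensHom_comp]
  congr 2
  funext r
  have : Subsingleton (Fin (fibre f r).card) := by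
    rw [← fibre_quasibijection hf r]
    exact inferInstanceAs (Subsingleton (Fin 1))
  rw [a.map_eq_eqToHom _ (Subsingleton.strictMono _)
    ((fibre_quasibijection hω r).symm.trans (fibre_quasibijection hf r)), Category.assoc,
    eqToHom_trans]

variable [SymmetricCategory V]

/-- Grouping is natural, and the restriction of `π` to a fibre over `S` is also the restriction of
`π_r` to the corresponding fibre over `S_r`. -/
lemma fibreGroup_fibreMap {T T' S R : NOrd I} {π : T ⟶ T'} (hπ : quasibijections I π) {σ : T' ⟶ S}
    {f : T ⟶ S} {ω : S ⟶ R} {g : T' ⟶ R} {k : T ⟶ R} (w₁ : f = π ≫ σ) (w₂ : g = σ ≫ ω)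
    (w₃ : k = f ≫ ω) (w₄ : k = π ≫ g) :
    fibreGroup X w₂ ≫ tensHom (fun r => a.fibreMap (quasibijections_fibreRestr hπ w₄ r)
      (fibreRestr_comp w₁ w₂ w₃ w₄ r)) R.elems = a.fibreMap hπ w₁ ≫ fibreGroup X w₃ := by
  rw [fibreGroup, fibreGroup, fibreMap, ← reassoc_of% (tensPerm_naturality (V := V)),
    reassoc_of% (tensGroup_naturality (V := V)), ← tensHom_comp]
  simp only [Category.assoc]
  rw [← tensHom_comp]
  congr 3
  funext r
  rw [fibreMap, ← tensHom_comp, ← tensHom_comp]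
  congr 1
  funext j
  refine (a.map_comp_eqToHom (fibre_fibreRestr w₃ r j).symm (fibre_fibreRestr w₂ r j).symm
    (hom_fibre_ext fun x => ?_) _ _).symm
  rw [fn_comp, fn_comp, fibreIncl_fibreMap, fibreIncl_eqToHom_fibreRestr,
    fibreIncl_eqToHom_fibreRestr, fibreIncl_fibreMap, fibreIncl_fibreMap]

end QuasiAction

lemma fibreReindex_fibreGroup [MonoidalCategory V] [SymmetricCategory V] (X : NOrd I → V)
    {T S S' R : NOrd I} {σ : T ⟶ S} {π : S ⟶ S'} (hπ : quasibijections I π) {ν : S' ⟶ R}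
    {g : T ⟶ S'} {ω : S ⟶ R} {f : T ⟶ R} (w₁ : g = σ ≫ π) (w₂ : ω = π ≫ ν) (w₃ : f = σ ≫ ω)
    (w₄ : f = g ≫ ν) :
    fibreReindex X hπ w₁ ≫ fibreGroup X w₃ = fibreGroup X w₄ ≫ tensHom (fun r =>
      fibreReindex X (quasibijections_fibreRestr hπ w₂ r) (fibreRestr_comp w₁ w₂ w₄ w₃ r))
      R.elems := by
  -- The bijection `π` carries the fibres of `ω` to those of `ν`, so one permutation followed by
  -- grouping equals grouping followed by a permutation in each group.
  have key := tensPerm_tensMap_tensGroup (fun s => X (fibre g s)) hπ.1 (h := fibreIncl ω)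
    (h' := fibreIncl ν) (fun r => (fibreIncl_strictMono ν r).injective)
    (p := fun r => fn (fibreRestr w₂ r)) (fun r j => fibreIncl_fibreMap _ _ _ _ _ _ _)
    (perm_bijection hπ) (perm_fibres ω) (perm_fibres ν)
    fun r => perm_bijection (quasibijections_fibreRestr hπ w₂ r)
  rw [fibreReindex, fibreGroup, fibreGroup]
  simp only [Category.assoc]
  rw [← reassoc_of% (tensPerm_naturality (fun s => eqToHom (congrArg X
    (fibre_comp_quasibijection hπ w₁ s)))), reassoc_of% (tensGroup_naturality
    (fun s => eqToHom (congrArg X (fibre_comp_quasibijection hπ w₁ s)))), reassoc_of% key,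
    ← tensHom_comp, ← tensHom_comp, ← tensHom_comp]
  congr 3
  funext r
  rw [← tensHom_comp]
  simp only [Category.assoc, eqToHom_trans]
  rw [fibreReindex, ← reassoc_of% (tensPerm_naturality (V := V)),
    reassoc_of% (tensMap_naturality (V := V)), ← tensHom_comp, ← tensHom_comp]
  simp only [eqToHom_trans]

end Ordinals
-- Extension of a `Q_n`-operad to an `n`-operad.
section Ordinals

open NOrd

variable {I : Type} [LinearOrder I] {V : Type u} [Category.{v} V] [MonoidalCategory V]

instance (F : PiQCollection I V) {T T' S : NOrd I} {π : T ⟶ T'} (hπ : quasibijections I π)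
    {σ : T' ⟶ S} {f : T ⟶ S} (w : f = π ≫ σ) : IsIso (F.quasiAction.fibreMap hπ w) := by
  unfold QuasiAction.fibreMap
  infer_instance

variable [SymmetricCategory V]

namespace QOperad

variable (C : QOperad I V)

lemma mul_comp_map {T T' T'' S : NOrd I} {σ : T ⟶ T''} {η : T'' ⟶ S} {σ' : T ⟶ T'}
    {η' : T' ⟶ S} {f : T ⟶ S} (hσ : quasibijections I σ) (hη : orderPreserving I η)
    (hσ' : quasibijections I σ') (hη' : orderPreserving I η') (w : f = σ ≫ η) (w' : f = σ' ≫ η') :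
    C.str.mul η' hη' ≫ C.F.quasiAction.map σ' hσ' =
      (C.F.val S ◁ (C.F.quasiAction.fibreMap hσ' w' ≫ inv (C.F.quasiAction.fibreMap hσ w))) ≫
        C.str.mul η hη ≫ C.F.quasiAction.map σ hσ := by
  have h : inv (C.F.quasiAction.fibreMap hσ w) = tensHom (fun s => inv
      (C.F.quasiAction.map (fibreRestr w s) (quasibijections_fibreRestr hσ w s))) S.elems := by
    refine IsIso.inv_eq_of_hom_inv_id ?_
    rw [QuasiAction.fibreMap, ← tensHom_comp]
    simp [tensHom_id]
  rw [h, QuasiAction.fibreMap, ← tensHom_comp]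
  exact C.equivariance₂ σ η σ' η' f hσ hη hσ' hη' w w'

lemma mul_comp_map_of_square {T' S' T S : NOrd I} {σ' : T' ⟶ S'} {σ : T ⟶ S} {π : T' ⟶ T}
    {ρ : S' ⟶ S} (hσ' : orderPreserving I σ') (hσ : orderPreserving I σ)
    (hπ : quasibijections I π) (hρ : quasibijections I ρ) {f : T' ⟶ S} (w : f = π ≫ σ)
    (w' : f = σ' ≫ ρ) :
    C.str.mul σ hσ ≫ C.F.quasiAction.map π hπ =
      (C.F.quasiAction.map ρ hρ ⊗ₘ
        (C.F.quasiAction.fibreMap hπ w ≫ fibreReindex C.F.val hρ w')) ≫ C.str.mul σ' hσ' := by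
  rw [QuasiAction.fibreMap, C.F.quasiAction.tensHom_comp_fibreReindex hπ hρ w w']
  exact C.equivariance₁ σ' σ π ρ hσ' hσ hπ hρ (w'.symm.trans w)

variable [OrderTop I]

/-- The multiplication of the extension of a `Q_n`-operad to an `n`-operad. -/
def extMul {T S : NOrd I} (σ : T ⟶ S) : C.F.val S ⊗ fibreTens C.F.val σ ⟶ C.F.val T :=
  let h := (exists_isFactorisation σ).choose_spec.choose_spec.choose_spec
  (C.F.val S ◁ inv (C.F.quasiAction.fibreMap h.quasibijection h.comp_eq.symm)) ≫
    C.str.mul _ h.orderPreserving ≫ C.F.quasiAction.map _ h.quasibijection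

/-- Independence of the chosen factorisation, by the second equivariance law. Since the action on
the fibres is invertible, this inverse-free form characterises `extMul f`. -/
lemma fibreMap_extMul {T T' S : NOrd I} {π : T ⟶ T'} {ν : T' ⟶ S} {f : T ⟶ S}
    (hπ : quasibijections I π) (hν : orderPreserving I ν) (w : f = π ≫ ν) :
    (C.F.val S ◁ C.F.quasiAction.fibreMap hπ w) ≫ C.extMul f =
      C.str.mul ν hν ≫ C.F.quasiAction.map π hπ := by
  have h := (exists_isFactorisation f).choose_spec.choose_spec.choose_spec
  rw [C.mul_comp_map h.quasibijection h.orderPreserving hπ hν h.comp_eq.symm w, extMul,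
    MonoidalCategory.whiskerLeft_comp, Category.assoc]

lemma extMul_of_orderPreserving {T S : NOrd I} {ν : T ⟶ S} (hν : orderPreserving I ν) :
    C.extMul ν = C.str.mul ν hν := by
  have := C.fibreMap_extMul (MorphismProperty.id_mem _ T) hν (Category.id_comp ν).symm
  rwa [QuasiAction.fibreMap_id, QuasiAction.map_id, MonoidalCategory.whiskerLeft_id,
    Category.id_comp, Category.comp_id] at this

/-- The analogue of `OperadStr.mul_comp_act`: a factorisation of `σ`, preceded by `π`, is a
factorisation of `f`. -/
lemma extMul_comp_map {T T' S : NOrd I} {π : T ⟶ T'} (hπ : quasibijections I π) {σ : T' ⟶ S}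
    {f : T ⟶ S} (w : f = π ≫ σ) :
    C.extMul σ ≫ C.F.quasiAction.map π hπ =
      (C.F.val S ◁ C.F.quasiAction.fibreMap hπ w) ≫ C.extMul f := by
  obtain ⟨T₀, π₀, ν₀, h⟩ := exists_isFactorisation σ
  have w' : f = (π ≫ π₀) ≫ ν₀ := by rw [w, ← h.comp_eq, Category.assoc]
  rw [← cancel_epi (C.F.val S ◁ C.F.quasiAction.fibreMap h.quasibijection h.comp_eq.symm),
    ← whiskerLeft_comp_assoc, C.F.quasiAction.fibreMap_comp hπ h.quasibijection w
    h.comp_eq.symm w', C.fibreMap_extMul _ h.orderPreserving, ← Category.assoc,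
    C.fibreMap_extMul _ h.orderPreserving, Category.assoc, QuasiAction.map_comp]

/-- The analogue of `OperadStr.act_tensorHom_comp_mul`, and the place where the first equivariance
law is used. -/
lemma map_tensorHom_comp_extMul {T S' S : NOrd I} {ρ : S' ⟶ S} (hρ : quasibijections I ρ)
    {σ : T ⟶ S'} {f : T ⟶ S} (w : f = σ ≫ ρ) :
    (C.F.quasiAction.map ρ hρ ⊗ₘ fibreReindex C.F.val hρ w) ≫ C.extMul σ = C.extMul f := by
  obtain ⟨T₀, π₀, ν₀, h₀⟩ := exists_isFactorisation σ
  -- Refactoring `ν₀ ≫ ρ` as `π ≫ ν` creates the square for the first equivariance law and the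
  -- factorisation `(π₀ ≫ π) ≫ ν` of `f`.
  obtain ⟨T₁, π, ν, h⟩ := exists_isFactorisation (ν₀ ≫ ρ)
  have hc := MorphismProperty.comp_mem _ _ _ h₀.quasibijection h.quasibijection
  have w₁ : f = (π₀ ≫ π) ≫ ν := by rw [w, ← h₀.comp_eq, Category.assoc, Category.assoc, h.comp_eq]
  have key : C.F.quasiAction.fibreMap hc w₁ ≫ fibreReindex C.F.val hρ w =
      (C.F.quasiAction.fibreMap h.quasibijection h.comp_eq.symm ≫ fibreReindex C.F.val hρ rfl) ≫
        C.F.quasiAction.fibreMap h₀.quasibijection h₀.comp_eq.symm := by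
    rw [QuasiAction.fibreMap, C.F.quasiAction.tensHom_comp_fibreReindex hc hρ w₁ w,
      QuasiAction.fibreMap, C.F.quasiAction.tensHom_comp_fibreReindex h.quasibijection hρ, QuasiAction.fibreMap,
      Category.assoc (obj := V), Category.assoc (obj := V), ← tensHom_comp]
    congr 3
    funext s
    exact (C.F.quasiAction.map_comp_eq (hom_fibre_ext fun _ => by simp)).symm
  rw [← cancel_epi (C.F.val S ◁ C.F.quasiAction.fibreMap hc w₁),
    C.fibreMap_extMul hc h.orderPreserving w₁,
    C.F.quasiAction.map_comp π₀ π h₀.quasibijection h.quasibijection, ← Category.assoc (C.str.mul _ _),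
    C.mul_comp_map_of_square h₀.orderPreserving h.orderPreserving h.quasibijection hρ
      h.comp_eq.symm rfl, Category.assoc, ← C.fibreMap_extMul h₀.quasibijection h₀.orderPreserving
      h₀.comp_eq.symm, ← id_tensorHom, ← id_tensorHom, tensorHom_comp_tensorHom_assoc,
      tensorHom_comp_tensorHom_assoc, key, Category.id_comp, Category.comp_id]

/-- The grouping of the factors in the associativity law of the extension, followed by the
multiplications of the fibres. -/
def extGroup {T S R : NOrd I} {σ : T ⟶ S} {ω : S ⟶ R} {f : T ⟶ R} (w : f = σ ≫ ω) :
    fibreTens C.F.val ω ⊗ fibreTens C.F.val σ ⟶ fibreTens C.F.val f :=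
  (fibreTens C.F.val ω ◁ fibreGroup C.F.val w) ≫
    tensZip (fun r => C.F.val (fibre ω r)) (fun r => fibreTens C.F.val (fibreRestr w r)) R.elems ≫
    tensHom (fun r => C.extMul (fibreRestr w r)) R.elems

/-- `extMul_comp_map` applied in every fibre over `R`. -/
lemma extGroup_comp_fibreMap {T T' S R : NOrd I} {π : T ⟶ T'} (hπ : quasibijections I π)
    {σ : T' ⟶ S} {f : T ⟶ S} {ω : S ⟶ R} {g : T' ⟶ R} {k : T ⟶ R} (w₁ : f = π ≫ σ)
    (w₂ : g = σ ≫ ω) (w₃ : k = f ≫ ω) (w₄ : k = π ≫ g) :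
    C.extGroup w₂ ≫ C.F.quasiAction.fibreMap hπ w₄ =
      (fibreTens C.F.val ω ◁ C.F.quasiAction.fibreMap hπ w₁) ≫ C.extGroup w₃ := by
  have h := tensZip_naturality (fun r => 𝟙 (C.F.val (fibre ω r))) (fun r =>
    C.F.quasiAction.fibreMap (quasibijections_fibreRestr hπ w₄ r)
      (fibreRestr_comp w₁ w₂ w₃ w₄ r)) R.elems
  rw [tensHom_id, id_tensorHom] at h
  rw [extGroup, extGroup, ← whiskerLeft_comp_assoc,
    ← C.F.quasiAction.fibreGroup_fibreMap hπ w₁ w₂ w₃ w₄, whiskerLeft_comp_assoc, reassoc_of% h,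
    QuasiAction.fibreMap, Category.assoc, Category.assoc, ← tensHom_comp, ← tensHom_comp]
  congr 3
  funext r
  rw [id_tensorHom]
  exact C.extMul_comp_map _ _

/-- `map_tensorHom_comp_extMul` applied in every fibre over `R`. -/
lemma fibreReindex_comp_extGroup {T S S' R : NOrd I} {σ : T ⟶ S} {π : S ⟶ S'}
    (hπ : quasibijections I π) {ν : S' ⟶ R} {g : T ⟶ S'} {ω : S ⟶ R} {f : T ⟶ R} (w₁ : g = σ ≫ π)
    (w₂ : ω = π ≫ ν) (w₃ : f = σ ≫ ω) (w₄ : f = g ≫ ν) :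
    (C.F.quasiAction.fibreMap hπ w₂ ⊗ₘ fibreReindex C.F.val hπ w₁) ≫ C.extGroup w₃ =
      C.extGroup w₄ := by
  rw [extGroup, extGroup, ← id_tensorHom, tensorHom_comp_tensorHom_assoc,
    fibreReindex_fibreGroup C.F.val hπ w₁ w₂ w₃ w₄, Category.comp_id, QuasiAction.fibreMap,
    ← Category.id_comp (tensHom _ R.elems), ← tensorHom_comp_tensorHom_assoc,
    reassoc_of% (tensZip_naturality (V := V)), ← tensHom_comp, id_tensorHom]
  congr 3
  funext r
  exact C.map_tensorHom_comp_extMul _ _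

/-- The associativity law of the extension for a composable pair. -/
def ExtAssoc {T S R : NOrd I} (σ : T ⟶ S) (ω : S ⟶ R) : Prop :=
  ∀ (f : T ⟶ R) (w : f = σ ≫ ω), (C.extMul ω ▷ fibreTens C.F.val σ) ≫ C.extMul σ =
    (α_ (C.F.val R) (fibreTens C.F.val ω) (fibreTens C.F.val σ)).hom ≫
      (C.F.val R ◁ C.extGroup w) ≫ C.extMul f

variable {C}

lemma ExtAssoc.of_orderPreserving {T S R : NOrd I} {σ : T ⟶ S} {ω : S ⟶ R}
    (hσ : orderPreserving I σ) (hω : orderPreserving I ω) : C.ExtAssoc σ ω := by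
  rintro f rfl
  have hr : ∀ r, orderPreserving I (fibreRestr (rfl : σ ≫ ω = σ ≫ ω) r) :=
    IsOperadic.restr_mem (W := orderPreserving I) σ ω hσ hω
  rw [extGroup, C.extMul_of_orderPreserving hσ, C.extMul_of_orderPreserving hω,
    C.extMul_of_orderPreserving (IsOperadic.comp_mem σ ω hσ hω),
    C.str.assoc_of_eq rfl hσ hω (IsOperadic.comp_mem σ ω hσ hω) hr]
  simp only [fun r => C.extMul_of_orderPreserving (hr r)]

/-- Composing the law for `ν`, `ω` with the action of `π` gives the law for `π ≫ ν`, `ω`, preceded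
by the invertible action of `π` on the fibres. -/
lemma ExtAssoc.quasibijection_comp {T T' S R : NOrd I} {π : T ⟶ T'} {ν : T' ⟶ S} {ω : S ⟶ R}
    (h : C.ExtAssoc ν ω) (hπ : quasibijections I π) : C.ExtAssoc (π ≫ ν) ω := by
  intro f w
  have w' : f = π ≫ (ν ≫ ω) := w.trans (Category.assoc _ _ _)
  have key := congrArg (· ≫ C.F.quasiAction.map π hπ) (h _ rfl)
  rw [Category.assoc, C.extMul_comp_map hπ rfl, Category.assoc, Category.assoc,
    C.extMul_comp_map hπ w', ← whiskerLeft_comp_assoc, C.extGroup_comp_fibreMap hπ rfl rfl w w',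
    ← whisker_exchange_assoc] at key
  rw [← cancel_epi ((C.F.val R ⊗ fibreTens C.F.val ω) ◁ C.F.quasiAction.fibreMap hπ rfl), key]
  simp

/-- A quasibijection in the middle may be moved from one map to the other: both laws agree after an
invertible morphism made of the action of `π` on the fibres and the reindexing along `π`. -/
lemma ExtAssoc.comp_quasibijection {T S S' R : NOrd I} {σ : T ⟶ S} {π : S ⟶ S'} {ν : S' ⟶ R}
    (hπ : quasibijections I π) (h : C.ExtAssoc (σ ≫ π) ν) : C.ExtAssoc σ (π ≫ ν) := by
  intro f w
  have w' : f = (σ ≫ π) ≫ ν := w.trans (Category.assoc _ _ _).symm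
  have key := h f w'
  rw [← C.map_tensorHom_comp_extMul hπ rfl, ← C.fibreReindex_comp_extGroup hπ rfl rfl w w',
    ← tensorHom_id, tensorHom_comp_tensorHom_assoc, C.extMul_comp_map hπ rfl, Category.id_comp]
    at key
  rw [← cancel_epi ((C.F.val R ◁ C.F.quasiAction.fibreMap hπ rfl) ⊗ₘ
    fibreReindex C.F.val hπ rfl), ← tensorHom_id, tensorHom_comp_tensorHom_assoc, Category.comp_id,
    key, MonoidalCategory.whiskerLeft_comp_assoc, ← id_tensorHom,
    ← associator_naturality_assoc, id_tensorHom]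

variable (C)

theorem extAssoc {T S R : NOrd I} (σ : T ⟶ S) (ω : S ⟶ R) : C.ExtAssoc σ ω := by
  obtain ⟨S', π, ν, h⟩ := exists_isFactorisation ω
  -- The quasibijection `π` is moved from `ω` into `σ` before factoring, so that only the order
  -- preserving pair `ν₁`, `ν` remains.
  obtain ⟨T', π₁, ν₁, h₁⟩ := exists_isFactorisation (σ ≫ π)
  rw [← h.comp_eq]
  refine ExtAssoc.comp_quasibijection h.quasibijection ?_
  rw [← h₁.comp_eq]
  exact (ExtAssoc.of_orderPreserving h₁.orderPreserving h.orderPreserving).quasibijection_comp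
    h₁.quasibijection

/-- The extension of a `Q_n`-operad to an `n`-operad. -/
@[simps]
def extStr : OperadStr ⊤ C.F.val where
  e := C.str.e
  mul σ _ := C.extMul σ
  assoc σ ω _ _ := by
    rw [C.extAssoc σ ω _ rfl, shuffle_eq]
    exact congrArg (fun g => (α_ _ (fibreTens C.F.val ω) (fibreTens C.F.val σ)).hom ≫
      (_ ◁ g) ≫ C.extMul (σ ≫ ω)) (Category.assoc _ _ _).symm
  mul_id T := by
    rw [C.extMul_of_orderPreserving (IsOperadic.id_mem T)]
    exact C.str.mul_id T
  mul_toUnit T := by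
    rw [C.extMul_of_orderPreserving (IsOperadic.toUnit_mem T)]
    exact C.str.mul_toUnit T

/-- Factor `π` as `π` followed by the identity; the unit law for the identity of `S` leaves the
action of `π`. In particular the extension is quasisymmetric. -/
lemma extStr_act {T S : NOrd I} (π : T ⟶ S) (hπ : quasibijections I π) :
    C.extStr.act π hπ = C.F.act π hπ := by
  have h := C.str.mul_id S
  rw [insertUnits_eq, Category.assoc] at h
  rw [OperadStr.act, insertUnits_eq, extStr_e, ← C.F.quasiAction.fibreUnits_fibreMap C.str.e
    (Category.comp_id π).symm hπ (MorphismProperty.id_mem _ S) hπ, extStr_mul,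
    MonoidalCategory.whiskerLeft_comp, Category.assoc, Category.assoc,
    C.fibreMap_extMul hπ (IsOperadic.id_mem S), reassoc_of% h]
  rfl

end QOperad

end Ordinals
-- The equivalence of categories.
section Ordinals

open NOrd

variable {I : Type} [LinearOrder I] {V : Type u} [Category.{v} V] [MonoidalCategory V]
  [SymmetricCategory V]

lemma OperadStr.IsHom.of_eq {W : MorphismProperty (NOrd I)} [IsOperadic W] {X : NOrd I → V}
    {A B : OperadStr W X} (he : A.e = B.e)
    (hm : ∀ {T S : NOrd I} (σ : T ⟶ S) (hσ : W σ), A.mul σ hσ = B.mul σ hσ) :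
    A.IsHom B fun T => 𝟙 (X T) where
  e_comp := (Category.comp_id _).trans he
  mul_comp σ hσ := by rw [tensHom_id, hm]; simp

/-- The components of a morphism of `Q_n`-operads. -/
def QOperad.Hom.val {C D : QOperad I V} (f : C ⟶ D) (T : NOrd I) : C.F.val T ⟶ D.F.val T :=
  f.app.app (op (FreeGroupoid.mk ⟨T⟩))

lemma QOperad.Hom.act_comp {C D : QOperad I V} (f : C ⟶ D) {T S : NOrd I} (σ : T ⟶ S)
    (hσ : quasibijections I σ) :
    C.F.act σ hσ ≫ val f T = val f S ≫ D.F.act σ hσ :=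
  f.app.naturality _

lemma isRestriction_restriction (A : QuasisymmetricOperad I V) :
    IsRestriction A.obj ((restriction I V).obj A) fun T => Iso.refl (A.obj.X T) where
  isHom := .of_eq rfl fun _ _ => rfl
  act_comp σ hσ := (Category.comp_id _).trans ((A.obj.str.quasiAction.collection_act A.property σ hσ).trans
    (Category.id_comp _).symm)

section OrderTop

variable [OrderTop I]

/-- The multiplications of `A` satisfy the identity `OperadStr.mul_comp_act`, which has only one
solution when the fibrewise actions are invertible. -/
lemma QOperad.extMul_ofOperadStr (F : PiQCollection I V) (A : OperadStr ⊤ F.val)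
    (hF : ∀ {T S : NOrd I} (σ : T ⟶ S) (hσ : quasibijections I σ), F.act σ hσ = A.act σ hσ)
    {T S : NOrd I} (σ : T ⟶ S) : (QOperad.ofOperadStr F A hF).extMul σ = A.mul σ trivial := by
  obtain ⟨T', π, ν, h⟩ := exists_isFactorisation σ
  have h₁ := (QOperad.ofOperadStr F A hF).fibreMap_extMul h.quasibijection h.orderPreserving
    h.comp_eq.symm
  have h₂ := A.mul_comp_act h.quasibijection h.comp_eq.symm
  simp only [← hF] at h₂
  exact (cancel_epi (F.val S ◁ F.quasiAction.fibreMap h.quasibijection h.comp_eq.symm)).1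
    (h₁.trans h₂)

lemma QOperad.Hom.isHom_ext {C D : QOperad I V} (f : C ⟶ D) :
    C.extStr.IsHom D.extStr (val f) where
  e_comp := f.isHom.e_comp
  mul_comp {T S} σ _ := by
    obtain ⟨T', π, ν, h⟩ := exists_isFactorisation σ
    have h₁ : C.F.quasiAction.fibreMap h.quasibijection h.comp_eq.symm ≫
        tensHom (fun s => val f (fibre σ s)) S.elems =
        tensHom (fun s => val f (fibre ν s)) S.elems ≫
        D.F.quasiAction.fibreMap h.quasibijection h.comp_eq.symm := by
      rw [QuasiAction.fibreMap, QuasiAction.fibreMap, ← tensHom_comp, ← tensHom_comp]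
      congr 1
      funext s
      exact act_comp f _ _
    have h₂ : C.str.mul ν h.orderPreserving ≫ val f T' =
        (val f S ⊗ₘ tensHom (fun s => val f (fibre ν s)) S.elems) ≫ D.str.mul ν h.orderPreserving :=
      f.isHom.mul_comp ν h.orderPreserving
    have h₃ := act_comp f π h.quasibijection
    change C.extMul σ ≫ _ = _ ≫ D.extMul σ
    -- After cancelling the fibrewise action, only multiplications for order preserving maps and
    -- actions of quasibijections are left, and `f` respects both.
    rw [← cancel_epi (C.F.val S ◁ C.F.quasiAction.fibreMap h.quasibijection h.comp_eq.symm),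
      ← Category.assoc, C.fibreMap_extMul h.quasibijection h.orderPreserving, Category.assoc,
      ← id_tensorHom, tensorHom_comp_tensorHom_assoc, h₁, Category.id_comp,
      ← Category.comp_id (val f S), ← tensorHom_comp_tensorHom_assoc,
      id_tensorHom, D.fibreMap_extMul h.quasibijection h.orderPreserving]
    exact (congrArg (_ ≫ ·) h₃).trans ((Category.assoc _ _ _).symm.trans
      ((congrArg (· ≫ _) h₂).trans (Category.assoc _ _ _)))

variable (I V) in
/-- The functor from `Q_n`-operads to quasisymmetric `n`-operads. -/
def extension : QOperad I V ⥤ QuasisymmetricOperad I V where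
  obj C := ⟨⟨C.F.val, C.extStr⟩, fun σ hσ => by rw [C.extStr_act]; infer_instance⟩
  map f := ⟨⟨QOperad.Hom.val f, QOperad.Hom.isHom_ext f⟩⟩
  map_id _ := rfl
  map_comp _ _ := rfl

lemma extMul_restriction (A : QuasisymmetricOperad I V) {T S : NOrd I} (σ : T ⟶ S) :
    ((restriction I V).obj A).extMul σ = A.obj.str.mul σ trivial :=
  QOperad.extMul_ofOperadStr (A.obj.str.quasiAction.collection A.property) A.obj.str
    (A.obj.str.quasiAction.collection_act A.property) σ

/-- A quasisymmetric `n`-operad is the extension of its restriction. -/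
def extensionRestriction (A : QuasisymmetricOperad I V) :
    A ≅ (extension I V).obj ((restriction I V).obj A) where
  hom := ⟨⟨fun T => 𝟙 (A.obj.X T), .of_eq rfl fun σ _ => (extMul_restriction A σ).symm⟩⟩
  inv := ⟨⟨fun T => 𝟙 (A.obj.X T), .of_eq rfl fun σ _ => extMul_restriction A σ⟩⟩
  hom_inv_id := ObjectProperty.hom_ext _ (NOperad.Hom.ext (funext fun _ => Category.id_comp _))
  inv_hom_id := ObjectProperty.hom_ext _ (NOperad.Hom.ext (funext fun _ => Category.id_comp _))

lemma restriction_extension_act (C : QOperad I V) {T S : NOrd I} (σ : T ⟶ S)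
    (hσ : quasibijections I σ) :
    ((restriction I V).obj ((extension I V).obj C)).F.act σ hσ = C.F.act σ hσ :=
  (((extension I V).obj C).obj.str.quasiAction.collection_act
    ((extension I V).obj C).property σ hσ).trans (C.extStr_act σ hσ)

/-- A `Q_n`-operad is the restriction of its extension. -/
def restrictionExtension (C : QOperad I V) :
    (restriction I V).obj ((extension I V).obj C) ≅ C where
  hom := ⟨PiQCollection.homMk (fun T => 𝟙 (C.F.val T)) fun σ hσ => (Category.comp_id _).trans
      ((restriction_extension_act C σ hσ).trans (Category.id_comp _).symm),
    .of_eq rfl fun _ hσ => C.extMul_of_orderPreserving hσ⟩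
  inv := ⟨PiQCollection.homMk (fun T => 𝟙 (C.F.val T)) fun σ hσ => (Category.comp_id _).trans
      ((restriction_extension_act C σ hσ).symm.trans (Category.id_comp _).symm),
    .of_eq rfl fun _ hσ => (C.extMul_of_orderPreserving hσ).symm⟩
  hom_inv_id := QOperad.Hom.ext (NatTrans.ext (funext fun _ => Category.id_comp _))
  inv_hom_id := QOperad.Hom.ext (NatTrans.ext (funext fun _ => Category.id_comp _))

variable (I V) in
/-- Quasisymmetric `n`-operads are equivalent to `Q_n`-operads. -/
def equivalence : QuasisymmetricOperad I V ≌ QOperad I V :=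
  CategoryTheory.Equivalence.mk (restriction I V) (extension I V)
    (NatIso.ofComponents extensionRestriction fun f => ObjectProperty.hom_ext _
      (NOperad.Hom.ext (funext fun _ =>
        (Category.comp_id (f.hom.app _)).trans (Category.id_comp (f.hom.app _)).symm)))
    (NatIso.ofComponents restrictionExtension fun _ => QOperad.Hom.ext (NatTrans.ext
      (funext fun _ => (Category.comp_id _).trans (Category.id_comp _).symm)))

lemma isExtension_extension (C : QOperad I V) :
    IsExtension C ((extension I V).obj C).obj fun T => Iso.refl (C.F.val T) where
  e_comp := Category.comp_id _
  mul_comp {T T' S} σ π ν hπ hν w := by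
    have h₁ : C.F.quasiAction.fibreMap hπ w ≫ tensHom (fun s => 𝟙 _ ≫
        inv (C.F.act (fibreRestr w s) (quasibijections_fibreRestr hπ w s))) S.elems = 𝟙 _ := by
      rw [QuasiAction.fibreMap, ← tensHom_comp]
      simp [tensHom_id]
    have h₂ : C.extMul σ = (𝟙 (C.F.val S) ⊗ₘ tensHom (fun s => 𝟙 _ ≫
        inv (C.F.act (fibreRestr w s) (quasibijections_fibreRestr hπ w s))) S.elems) ≫
        C.str.mul ν hν ≫ C.F.act π hπ := by
      rw [← cancel_epi (C.F.val S ◁ C.F.quasiAction.fibreMap hπ w), C.fibreMap_extMul hπ hν w,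
        id_tensorHom, ← whiskerLeft_comp_assoc, h₁, MonoidalCategory.whiskerLeft_id,
        Category.id_comp]
      rfl
    exact (Category.comp_id _).trans h₂

end OrderTop

end Ordinals
end NOperads

end

theorem mainTheorem6 {V : Type u} [Category.{v} V] [MonoidalCategory V] [SymmetricCategory V]
    (n : ℕ∞) (hn : 1 ≤ n) :
    (∀ {T S : NOrd (Level n)} (σ : T ⟶ S),
      ∃ (T' : NOrd (Level n)) (π : T ⟶ T') (ν : T' ⟶ S), IsFactorisation σ π ν) ∧
    ∃ E : QuasisymmetricOperad (Level n) V ≌ QOperad (Level n) V,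
      (∃ θ : E.functor ⋙ QOperad.forget (Level n) V ≅ QuasisymmetricOperad.forget (Level n) V,
        ∀ A : QuasisymmetricOperad (Level n) V,
          IsRestriction A.obj (E.functor.obj A) fun T => Pi.isoApp (θ.app A) T) ∧
      (∃ θ : E.inverse ⋙ QuasisymmetricOperad.forget (Level n) V ≅ QOperad.forget (Level n) V,
        ∀ C : QOperad (Level n) V,
          IsExtension C (E.inverse.obj C).obj fun T => Pi.isoApp (θ.app C) T) := by
  -- The factorisation needs a greatest level: `n - 1` for finite `n`, and `0` for `n = ∞`. For `n =
  -- 0` there would be no level at all.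
  have : Nonempty (OrderTop (Level n)) := by
    cases n with
    | top => exact ⟨{ top := ⟨0, le_rfl⟩, le_top := fun p => p.2 }⟩
    | coe n =>
      obtain ⟨m, rfl⟩ : ∃ m, n = m + 1 := Nat.exists_eq_add_of_le' (by exact_mod_cast hn)
      exact ⟨inferInstanceAs (OrderTop (Fin (m + 1)))⟩
  have := this.some
  refine ⟨NOrd.exists_isFactorisation, equivalence (Level n) V, ⟨Iso.refl _, ?_⟩, ⟨Iso.refl _, ?_⟩⟩
  · exact isRestriction_restriction
  · exact isExtension_extension
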